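/- Let $k$ be an algebraically closed field of characteristic zero and let $\mathcal C$ be a fusion category over $k$ (a $k$-linear abelian semisimple rigid tensor category with finitely many isomorphism classes of simple objects, finite-dimensional spaces of morphisms and simple unit object $\mathbf 1$). Let $G$ be a finite group with identity $e$, let $\omega$ be a 3-cocycle of $\mathbb Z_2$ with values in $k^\times$ (trivial action), and let $\mathrm{Vec}_{\mathbb Z_2}^{\omega}$ be the category of finite-dimensional $\mathbb Z_2$-graded vector spaces with associativity given by $\omega$. Suppose that $\mathcal C$ is a $G$-extension of $\mathrm{Vec}_{\mathbb Z_2}^{\omega}$: there is a faithful grading $\mathcal C=\bigoplus_{g\in G}\mathcal C_g$ (a decomposition into full abelian subcategories with $\mathcal C_g\ne 0$, $\mathcal C_g\otimes\mathcal C_h\subseteq\mathcal C_{gh}$ and $(\mathcal C_g)^*=\mathcal C_{g^{-1}}$ for all $g,h$) whose trivial component $\mathcal C_e$ is equivalent to $\mathrm{Vec}_{\mathbb Z_2}^{\omega}$ as a $k$-linear tensor category. A simple object $X$ is invertible if $X\otimes X^*\cong\mathbf 1$; $\mathcal C$ is pointed if all its simple objects are invertible; $\mathcal C$ is a generalized Tambara–Yamagami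 category if it is not pointed and the tensor product of any two non-invertible simple objects is a direct sum of invertible objects. $G(\mathcal C)$ is the group of isomorphism classes of invertible objects; $\mathcal C_{ad}$ is the fusion subcategory generated by the simple summands of $X\otimes X^*$ for all simple $X$; $U(\mathcal C)$ is the universal grading group of $\mathcal C$, i.e. the grading group of the universal grading of $\mathcal C$, from which every other grading of $\mathcal C$ is induced by a unique group homomorphism. Then: 1. If the class of $\omega$ in $H^3(\mathbb Z_2,k^\times)$ is nontrivial, then $\mathcal C$ is pointed. 2. If the class of $\omega$ is trivial, then $\mathcal C$ is either pointed or a generalized Tambara–Yamagami category. If $\mathcal C$ is a generalized Tambara–Yamagami category, then there is an integer $n\geq 1$ such that: (i) $|G(\mathcal C)|=2n$ and $\mathcal C$ is of type $(1,2n;\sqrt2,n)$, i.e. it has, up to isomorphism, exactly $2n$ simple objects of Frobenius–Perron dimension $1$, exactly $n$ simple objects of Frobenius–Perron dimension $\sqrt2$, and no other simple objects; (ii) $\mathcal C_e=\mathcal C_{ad}$; the grading $\mathcal C=\bigoplus_{g\in G}\mathcal C_g$ is the universal grading, that is, there is an isomorphism $U(\mathcal C)\cong G$ which identifies the components of the universal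 grading with those of the given one; and $|U(\mathcal C)|=2n$. -/

import Mathlib

open CategoryTheory MonoidalCategory Limits
open scoped TensorProduct

universe u v w t

/-- A 3-cocycle of a group `Γ` with values in the trivial `Γ`-module `kˣ` (not assumed
normalized). -/
structure ThreeCocycle (Γ : Type v) [Group Γ] (k : Type u) [Field k] where
  toFun : Γ → Γ → Γ → kˣ
  cocycle : ∀ a b c d : Γ,
    toFun a b c * toFun a (b * c) d * toFun b c d = toFun (a * b) c d * toFun a b (c * d)

namespace ThreeCocycle

variable {Γ : Type v} [Group Γ] {k : Type u} [Field k]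

instance : CoeFun (ThreeCocycle Γ k) (fun _ => Γ → Γ → Γ → kˣ) := ⟨toFun⟩

/-- The class of `ω` in `H³(Γ, kˣ)` is trivial, i.e. `ω` is the coboundary of a 2-cochain. -/
def IsTrivial (ω : ThreeCocycle Γ k) : Prop :=
  ∃ η : Γ → Γ → kˣ, ∀ a b c : Γ, ω a b c = η b c * (η (a * b) c)⁻¹ * η a (b * c) * (η a b)⁻¹

theorem mid (ω : ThreeCocycle Γ k) (a b : Γ) : ω a 1 b = ω a 1 1 * ω 1 1 b := by
  have h := ω.cocycle a 1 1 b
  simp only [mul_one, one_mul] at h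
  have h2 : ω a 1 b * (ω a 1 1 * ω 1 1 b) = ω a 1 b * ω a 1 b := by
    rw [← h, mul_comm (ω a 1 1) (ω a 1 b), mul_assoc]
  exact (mul_left_cancel h2).symm

end ThreeCocycle

/-- Objects of `Vec_Γ^ω`: finite-dimensional `Γ`-graded `k`-vector spaces. The grading is given
by the projections `proj a` onto the homogeneous components. -/
structure TwistedVect {Γ : Type v} [Group Γ] [Fintype Γ] {k : Type u} [Field k]
    (ω : ThreeCocycle Γ k) where
  carrier : Type u
  [addCommGroup : AddCommGroup carrier]
  [module : Module k carrier]
  [finiteDimensional : FiniteDimensional k carrier]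
  proj : Γ → Module.End k carrier
  isComplete : CompleteOrthogonalIdempotents proj

namespace TwistedVect

variable {Γ : Type v} [Group Γ] [Fintype Γ] {k : Type u} [Field k] {ω : ThreeCocycle Γ k}

attribute [instance] addCommGroup module finiteDimensional

/-- Morphisms of graded vector spaces: linear maps preserving degrees. -/
@[ext]
structure Hom (V W : TwistedVect ω) where
  lin : V.carrier →ₗ[k] W.carrier
  comm : ∀ (a : Γ) (v : V.carrier), lin (V.proj a v) = W.proj a (lin v)

instance : Category (TwistedVect ω) where
  Hom V W := Hom V W
  id V := ⟨LinearMap.id, fun _ _ => rfl⟩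
  comp f g := ⟨g.lin ∘ₗ f.lin, fun a v => by simp [f.comm, g.comm]⟩

/-- The linear map underlying a morphism. -/
def toLin {V W : TwistedVect ω} (f : V ⟶ W) : V.carrier →ₗ[k] W.carrier := Hom.lin f

/-- A degree-preserving linear map as a morphism. -/
def ofLin {V W : TwistedVect ω} (f : V.carrier →ₗ[k] W.carrier)
    (h : ∀ (a : Γ) (v : V.carrier), f (V.proj a v) = W.proj a (f v)) : V ⟶ W := Hom.mk f h

section basics

variable {V W X : TwistedVect ω}

@[simp] theorem toLin_ofLin (f : V.carrier →ₗ[k] W.carrier)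
    (h : ∀ (a : Γ) (v : V.carrier), f (V.proj a v) = W.proj a (f v)) :
    toLin (ofLin f h) = f := rfl

@[simp] theorem toLin_id : toLin (𝟙 V) = LinearMap.id := rfl

@[simp] theorem toLin_comp (f : V ⟶ W) (g : W ⟶ X) : toLin (f ≫ g) = toLin g ∘ₗ toLin f := rfl

theorem toLin_comm (f : V ⟶ W) (a : Γ) (v : V.carrier) :
    toLin f (V.proj a v) = W.proj a (toLin f v) := Hom.comm f a v

theorem toLin_injective : Function.Injective (toLin : (V ⟶ W) → _) := fun _ _ h => Hom.ext h

end basics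

instance (V W : TwistedVect ω) : Zero (V ⟶ W) := ⟨ofLin 0 (by simp)⟩
instance (V W : TwistedVect ω) : Add (V ⟶ W) :=
  ⟨fun f g => ofLin (toLin f + toLin g) (by simp [toLin_comm])⟩
instance (V W : TwistedVect ω) : Neg (V ⟶ W) := ⟨fun f => ofLin (-toLin f) (by simp [toLin_comm])⟩
instance (V W : TwistedVect ω) : Sub (V ⟶ W) :=
  ⟨fun f g => ofLin (toLin f - toLin g) (by simp [toLin_comm])⟩
instance (V W : TwistedVect ω) : SMul ℕ (V ⟶ W) :=
  ⟨fun n f => ofLin (n • toLin f) (by simp [toLin_comm])⟩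
instance (V W : TwistedVect ω) : SMul ℤ (V ⟶ W) :=
  ⟨fun n f => ofLin (n • toLin f) (by simp [toLin_comm])⟩
instance (V W : TwistedVect ω) : SMul k (V ⟶ W) :=
  ⟨fun c f => ofLin (c • toLin f) (by simp [toLin_comm])⟩

instance (V W : TwistedVect ω) : AddCommGroup (V ⟶ W) :=
  Function.Injective.addCommGroup toLin toLin_injective rfl (fun _ _ => rfl) (fun _ => rfl)
    (fun _ _ => rfl) (fun _ _ => rfl) (fun _ _ => rfl)

@[simp] theorem toLin_add {V W : TwistedVect ω} (f g : V ⟶ W) :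
    toLin (f + g) = toLin f + toLin g := rfl

@[simp] theorem toLin_smul {V W : TwistedVect ω} (c : k) (f : V ⟶ W) :
    toLin (c • f) = c • toLin f := rfl

instance (V W : TwistedVect ω) : Module k (V ⟶ W) :=
  Function.Injective.module k (⟨⟨toLin, rfl⟩, fun _ _ => rfl⟩ : (V ⟶ W) →+ _)
    toLin_injective (fun _ _ => rfl)

instance : Preadditive (TwistedVect ω) where
  add_comp _ _ _ f f' g := toLin_injective (by simp [LinearMap.comp_add])
  comp_add _ _ _ f g g' := toLin_injective (by simp [LinearMap.add_comp])

instance : Linear k (TwistedVect ω) where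
  smul_comp _ _ _ c f g := toLin_injective (by simp [LinearMap.comp_smul])
  comp_smul _ _ _ f c g := toLin_injective (by simp [LinearMap.smul_comp])

open Classical in
theorem proj_proj (V : TwistedVect ω) (a b : Γ) (v : V.carrier) :
    V.proj a (V.proj b v) = if a = b then V.proj a v else 0 := by
  have h := DFunLike.congr_fun (V.isComplete.mul_eq a b) v
  split_ifs with hab <;> simpa [hab] using h

theorem sum_proj (V : TwistedVect ω) (v : V.carrier) : ∑ a, V.proj a v = v := by
  simpa using DFunLike.congr_fun V.isComplete.complete v

/-- `v` is homogeneous of degree `a`. -/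
def IsHomog {V : TwistedVect ω} (a : Γ) (v : V.carrier) : Prop := V.proj a v = v

theorem isHomog_proj (V : TwistedVect ω) (a : Γ) (v : V.carrier) : IsHomog a (V.proj a v) := by
  simp [IsHomog, proj_proj]

open Classical in
theorem IsHomog.proj_eq {V : TwistedVect ω} {a : Γ} {v : V.carrier} (h : IsHomog a v) (b : Γ) :
    V.proj b v = if b = a then v else 0 := by
  rw [← show V.proj a v = v from h, proj_proj]
  split_ifs with hb
  · rw [hb]
  · rfl

theorem hom_ext {V : TwistedVect ω} {M : Type*} [AddCommGroup M] [Module k M]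
    {f g : V.carrier →ₗ[k] M} (h : ∀ (a : Γ) (v : V.carrier), IsHomog a v → f v = g v) : f = g := by
  ext v
  rw [← V.sum_proj v, map_sum, map_sum]
  exact Finset.sum_congr rfl fun a _ => h a _ (V.isHomog_proj a v)

theorem tensor_ext {V W : TwistedVect ω} {M : Type*} [AddCommGroup M] [Module k M]
    {f g : V.carrier ⊗[k] W.carrier →ₗ[k] M}
    (h : ∀ (a b : Γ) (v : V.carrier) (w : W.carrier), IsHomog a v → IsHomog b w →
      f (v ⊗ₜ w) = g (v ⊗ₜ w)) : f = g := by
  apply TensorProduct.ext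
  refine hom_ext fun a v hv => ?_
  refine hom_ext fun b w hw => ?_
  exact h a b v w hv hw

/-- The projection of `V ⊗ W` onto its component of degree `a`, which is
`⨁_{b * c = a} V_b ⊗ W_c`. -/
def tensorProj (V W : TwistedVect ω) (a : Γ) : Module.End k (V.carrier ⊗[k] W.carrier) :=
  ∑ b, TensorProduct.map (V.proj b) (W.proj (b⁻¹ * a))

open Classical in
theorem tensorProj_apply {V W : TwistedVect ω} {a b : Γ} {v : V.carrier} {w : W.carrier}
    (hv : IsHomog a v) (hw : IsHomog b w) (c : Γ) :
    tensorProj V W c (v ⊗ₜ w) = if c = a * b then v ⊗ₜ w else 0 := by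
  simp only [tensorProj, LinearMap.sum_apply, TensorProduct.map_tmul, hv.proj_eq, hw.proj_eq]
  rw [Finset.sum_eq_single a]
  · by_cases h : c = a * b
    · simp [h]
    · have : ¬ a⁻¹ * c = b := fun h' => h (by rw [← h']; simp)
      simp [h, this]
  · intro d _ hd
    simp [hd]
  · simp

/-- The tensor product of graded vector spaces. -/
abbrev tensor (V W : TwistedVect ω) : TwistedVect ω where
  carrier := V.carrier ⊗[k] W.carrier
  proj := tensorProj V W
  isComplete := by
    classical
    rw [CompleteOrthogonalIdempotents.iff_ortho_complete]
    constructor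
    · intro c d hcd
      refine tensor_ext fun a b v w hv hw => ?_
      simp only [Module.End.mul_apply, tensorProj_apply hv hw, LinearMap.zero_apply]
      by_cases hd : d = a * b
      · have hc : ¬ c = a * b := fun h => hcd (h.trans hd.symm)
        rw [if_pos hd, tensorProj_apply hv hw, if_neg hc]
      · rw [if_neg hd, map_zero]
    · refine tensor_ext fun a b v w hv hw => ?_
      simp [LinearMap.sum_apply, tensorProj_apply hv hw]

theorem IsHomog.tmul {V W : TwistedVect ω} {a b : Γ} {v : V.carrier} {w : W.carrier}
    (hv : IsHomog a v) (hw : IsHomog b w) : IsHomog (V := tensor V W) (a * b) (v ⊗ₜ[k] w) := by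
  classical
  exact (tensorProj_apply hv hw (a * b)).trans (if_pos rfl)

theorem IsHomog.toLin {V W : TwistedVect ω} {a : Γ} {v : V.carrier} (hv : IsHomog a v)
    (f : V ⟶ W) : IsHomog a (toLin f v) := by
  unfold IsHomog
  rw [← toLin_comm, show V.proj a v = v from hv]

theorem IsHomog.smul {V : TwistedVect ω} {a : Γ} {v : V.carrier} (hv : IsHomog a v)
    (c : k) : IsHomog a (c • v) := by
  unfold IsHomog
  rw [map_smul, show V.proj a v = v from hv]

/-- Constructor for morphisms: it is enough to send homogeneous elements to homogeneous ones. -/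
def ofHomog {V W : TwistedVect ω} (f : V.carrier →ₗ[k] W.carrier)
    (h : ∀ (a : Γ) (v : V.carrier), IsHomog a v → IsHomog a (f v)) : V ⟶ W :=
  ofLin f (by
    classical
    intro a v
    suffices f ∘ₗ V.proj a = W.proj a ∘ₗ f from DFunLike.congr_fun this v
    refine hom_ext fun b v hv => ?_
    simp only [LinearMap.comp_apply, hv.proj_eq, (h b v hv).proj_eq]
    split_ifs <;> simp)

theorem tensor_ext₃ {V W X : TwistedVect ω} {M : Type*} [AddCommGroup M] [Module k M]
    {f g : (V.carrier ⊗[k] W.carrier) ⊗[k] X.carrier →ₗ[k] M}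
    (h : ∀ (a b c : Γ) (v : V.carrier) (w : W.carrier) (x : X.carrier), IsHomog a v →
      IsHomog b w → IsHomog c x → f ((v ⊗ₜ w) ⊗ₜ x) = g ((v ⊗ₜ w) ⊗ₜ x)) : f = g := by
  apply TensorProduct.ext
  refine tensor_ext fun a b v w hv hw => ?_
  exact hom_ext fun c x hx => h a b c v w x hv hw hx

theorem tensor_ext₄ {V W X Y : TwistedVect ω} {M : Type*} [AddCommGroup M] [Module k M]
    {f g : ((V.carrier ⊗[k] W.carrier) ⊗[k] X.carrier) ⊗[k] Y.carrier →ₗ[k] M}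
    (h : ∀ (a b c d : Γ) (v : V.carrier) (w : W.carrier) (x : X.carrier) (y : Y.carrier),
      IsHomog a v → IsHomog b w → IsHomog c x → IsHomog d y →
        f (((v ⊗ₜ w) ⊗ₜ x) ⊗ₜ y) = g (((v ⊗ₜ w) ⊗ₜ x) ⊗ₜ y)) : f = g := by
  apply TensorProduct.ext
  refine tensor_ext₃ fun a b c v w x hv hw hx => ?_
  exact hom_ext fun d y hy => h a b c d v w x y hv hw hx hy

theorem comm_of_comp {V W : TwistedVect ω} {f : V.carrier →ₗ[k] W.carrier}
    (h : ∀ a, f ∘ₗ V.proj a = W.proj a ∘ₗ f) (a : Γ) (v : V.carrier) :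
    f (V.proj a v) = W.proj a (f v) := DFunLike.congr_fun (h a) v

open Classical in
/-- The unit object: `k` in degree `1`. -/
noncomputable abbrev unit (ω : ThreeCocycle Γ k) : TwistedVect ω where
  carrier := k
  proj a := if a = 1 then 1 else 0
  isComplete := by
    rw [CompleteOrthogonalIdempotents.iff_ortho_complete]
    constructor
    · intro a b hab
      by_cases ha : a = 1
      · have hb : ¬ b = 1 := fun h => hab (ha.trans h.symm)
        simp [hb]
      · simp [ha]
    · simp

theorem isHomog_unit (c : k) : IsHomog (V := unit ω) 1 c := by
  simp only [IsHomog, if_true]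
  rfl

theorem tensorMap_comm {V W V' W' : TwistedVect ω} (f : V ⟶ V') (g : W ⟶ W') (a : Γ)
    (t : V.carrier ⊗[k] W.carrier) :
    TensorProduct.map (toLin f) (toLin g) (tensorProj V W a t) =
      tensorProj V' W' a (TensorProduct.map (toLin f) (toLin g) t) := by
  classical
  suffices TensorProduct.map (toLin f) (toLin g) ∘ₗ tensorProj V W a =
      tensorProj V' W' a ∘ₗ TensorProduct.map (toLin f) (toLin g) from DFunLike.congr_fun this t
  refine tensor_ext fun b c v w hv hw => ?_
  rw [LinearMap.comp_apply, LinearMap.comp_apply, tensorProj_apply hv hw, TensorProduct.map_tmul,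
    tensorProj_apply (hv.toLin f) (hw.toLin g)]
  split_ifs <;> simp

/-- The tensor product of two morphisms. -/
def tensorMap {V W V' W' : TwistedVect ω} (f : V ⟶ V') (g : W ⟶ W') :
    tensor V W ⟶ tensor V' W' :=
  ofLin (V := tensor V W) (W := tensor V' W') (TensorProduct.map (toLin f) (toLin g))
    (tensorMap_comm f g)

/-- The associativity map of `Vec_Γ^ω`: on homogeneous elements of degrees `a`, `b`, `c` it is
`(v ⊗ w) ⊗ x ↦ ω a b c • v ⊗ (w ⊗ x)`. -/
def assocLin (V W X : TwistedVect ω) :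
    (V.carrier ⊗[k] W.carrier) ⊗[k] X.carrier →ₗ[k] V.carrier ⊗[k] (W.carrier ⊗[k] X.carrier) :=
  (∑ a, ∑ b, ∑ c, (ω a b c : k) •
    TensorProduct.map (V.proj a) (TensorProduct.map (W.proj b) (X.proj c))) ∘ₗ
      (TensorProduct.assoc k V.carrier W.carrier X.carrier).toLinearMap

/-- The inverse of the associativity map. -/
def assocInvLin (V W X : TwistedVect ω) :
    V.carrier ⊗[k] (W.carrier ⊗[k] X.carrier) →ₗ[k] (V.carrier ⊗[k] W.carrier) ⊗[k] X.carrier :=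
  (TensorProduct.assoc k V.carrier W.carrier X.carrier).symm.toLinearMap ∘ₗ
    (∑ a, ∑ b, ∑ c, ((ω a b c)⁻¹ : kˣ).val •
      TensorProduct.map (V.proj a) (TensorProduct.map (W.proj b) (X.proj c)))

theorem sum_apply_homog {V W X : TwistedVect ω} (θ : Γ → Γ → Γ → k) {a b c : Γ} {v : V.carrier}
    {w : W.carrier} {x : X.carrier} (hv : IsHomog a v) (hw : IsHomog b w) (hx : IsHomog c x) :
    (∑ a, ∑ b, ∑ c, θ a b c •
      TensorProduct.map (V.proj a) (TensorProduct.map (W.proj b) (X.proj c)))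
        (v ⊗ₜ[k] (w ⊗ₜ[k] x)) = θ a b c • (v ⊗ₜ[k] (w ⊗ₜ[k] x)) := by
  classical
  simp only [LinearMap.sum_apply, LinearMap.smul_apply, TensorProduct.map_tmul, hv.proj_eq,
    hw.proj_eq, hx.proj_eq]
  rw [Finset.sum_eq_single a, Finset.sum_eq_single b, Finset.sum_eq_single c]
  · simp
  · intro d _ hd; simp [hd]
  · simp
  · intro d _ hd; simp [hd]
  · simp
  · intro d _ hd; simp [hd]
  · simp

theorem assocLin_apply {V W X : TwistedVect ω} {a b c : Γ} {v : V.carrier}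
    {w : W.carrier} {x : X.carrier} (hv : IsHomog a v) (hw : IsHomog b w) (hx : IsHomog c x) :
    assocLin V W X ((v ⊗ₜ w) ⊗ₜ x) = (ω a b c : k) • (v ⊗ₜ (w ⊗ₜ x)) :=
  sum_apply_homog (fun a b c => (ω a b c : k)) hv hw hx

theorem assocInvLin_apply {V W X : TwistedVect ω} {a b c : Γ} {v : V.carrier}
    {w : W.carrier} {x : X.carrier} (hv : IsHomog a v) (hw : IsHomog b w) (hx : IsHomog c x) :
    assocInvLin V W X (v ⊗ₜ (w ⊗ₜ x)) = ((ω a b c)⁻¹ : kˣ).val • ((v ⊗ₜ w) ⊗ₜ x) := by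
  rw [assocInvLin, LinearMap.comp_apply,
    sum_apply_homog (fun a b c => ((ω a b c)⁻¹ : kˣ).val) hv hw hx]
  simp

theorem tensor_ext₃' {V W X : TwistedVect ω} {M : Type*} [AddCommGroup M] [Module k M]
    {f g : V.carrier ⊗[k] (W.carrier ⊗[k] X.carrier) →ₗ[k] M}
    (h : ∀ (a b c : Γ) (v : V.carrier) (w : W.carrier) (x : X.carrier), IsHomog a v →
      IsHomog b w → IsHomog c x → f (v ⊗ₜ (w ⊗ₜ x)) = g (v ⊗ₜ (w ⊗ₜ x))) : f = g := by
  apply TensorProduct.ext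
  refine hom_ext fun a v hv => ?_
  exact tensor_ext fun b c w x hw hx => h a b c v w x hv hw hx

/-- An isomorphism from a pair of mutually inverse linear maps, the first of which preserves
degrees. -/
def isoOfLin {V W : TwistedVect ω} (f : V.carrier →ₗ[k] W.carrier) (g : W.carrier →ₗ[k] V.carrier)
    (hf : ∀ (a : Γ) (v : V.carrier), f (V.proj a v) = W.proj a (f v))
    (hfg : g ∘ₗ f = LinearMap.id) (hgf : f ∘ₗ g = LinearMap.id) : V ≅ W where
  hom := ofLin f hf
  inv := ofLin g (fun a w => by
    have h1 : ∀ v, g (f v) = v := fun v => DFunLike.congr_fun hfg v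
    have h2 : ∀ w, f (g w) = w := fun w => DFunLike.congr_fun hgf w
    rw [← h1 (V.proj a (g w)), hf, h2])
  hom_inv_id := toLin_injective hfg
  inv_hom_id := toLin_injective hgf

@[simp] theorem toLin_isoOfLin_hom {V W : TwistedVect ω} (f : V.carrier →ₗ[k] W.carrier)
    (g : W.carrier →ₗ[k] V.carrier) (hf hfg hgf) :
    toLin (isoOfLin (V := V) (W := W) f g hf hfg hgf).hom = f := rfl

theorem assocLin_comm (V W X : TwistedVect ω) (d : Γ)
    (t : (V.carrier ⊗[k] W.carrier) ⊗[k] X.carrier) :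
    assocLin V W X (tensorProj (tensor V W) X d t) =
      tensorProj V (tensor W X) d (assocLin V W X t) := by
  classical
  suffices assocLin V W X ∘ₗ tensorProj (tensor V W) X d =
      tensorProj V (tensor W X) d ∘ₗ assocLin V W X from DFunLike.congr_fun this t
  refine tensor_ext₃ fun a b c v w x hv hw hx => ?_
  rw [LinearMap.comp_apply, LinearMap.comp_apply, assocLin_apply hv hw hx,
    tensorProj_apply (V := tensor V W) (hv.tmul hw) hx, map_smul,
    tensorProj_apply (W := tensor W X) hv (hw.tmul hx), mul_assoc]
  split_ifs
  · exact assocLin_apply hv hw hx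
  · simp

/-- The associativity isomorphism. -/
def assocIso (V W X : TwistedVect ω) : tensor (tensor V W) X ≅ tensor V (tensor W X) :=
  isoOfLin (V := tensor (tensor V W) X) (W := tensor V (tensor W X))
    (assocLin V W X) (assocInvLin V W X) (assocLin_comm V W X)
    (tensor_ext₃ fun a b c v w x hv hw hx => by
      simp [assocLin_apply hv hw hx, assocInvLin_apply hv hw hx, smul_smul])
    (tensor_ext₃' fun a b c v w x hv hw hx => by
      simp [assocLin_apply hv hw hx, assocInvLin_apply hv hw hx, smul_smul])

/-- Rescaling of the component of degree `a` by `θ a`, for every `a`. -/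
def rescale (V : TwistedVect ω) (θ : Γ → k) : V.carrier →ₗ[k] V.carrier := ∑ a, θ a • V.proj a

theorem rescale_apply {V : TwistedVect ω} (θ : Γ → k) {a : Γ} {v : V.carrier}
    (hv : IsHomog a v) : rescale V θ v = θ a • v := by
  classical
  simp only [rescale, LinearMap.sum_apply, LinearMap.smul_apply, hv.proj_eq]
  rw [Finset.sum_eq_single a]
  · simp
  · intro d _ hd; simp [hd]
  · simp

/-- The left unit isomorphism: `r ⊗ v ↦ (ω 1 1 a)⁻¹ • r • v` for `v` of degree `a`. -/
noncomputable def leftUnitIso (V : TwistedVect ω) : tensor (unit ω) V ≅ V :=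
  isoOfLin (V := tensor (unit ω) V) (W := V)
    (rescale V (fun a => ((ω 1 1 a)⁻¹ : kˣ).val) ∘ₗ (TensorProduct.lid k V.carrier).toLinearMap)
    ((TensorProduct.lid k V.carrier).symm.toLinearMap ∘ₗ rescale V (fun a => (ω 1 1 a : k)))
    (comm_of_comp (by
      classical
      intro d
      refine tensor_ext (V := unit ω) fun a b r v hr hv => ?_
      change rescale V _ (TensorProduct.lid k V.carrier
          ((tensor (unit ω) V).proj d (r ⊗ₜ[k] v))) =
        V.proj d (rescale V _ (TensorProduct.lid k V.carrier (r ⊗ₜ[k] v)))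
      have hr : IsHomog (V := unit ω) 1 r := isHomog_unit r
      have hp : (tensor (unit ω) V).proj d (r ⊗ₜ[k] v) = if d = b then r ⊗ₜ[k] v else 0 := by
        have := (hr.tmul hv).proj_eq d
        rwa [one_mul] at this
      rw [hp, TensorProduct.lid_tmul, map_smul, rescale_apply _ hv, map_smul, map_smul, hv.proj_eq]
      split_ifs
      · rw [TensorProduct.lid_tmul, map_smul, rescale_apply _ hv]
      · simp))
    (tensor_ext (V := unit ω) fun a b r v hr hv => by
      simp [rescale_apply _ hv, smul_smul, TensorProduct.smul_tmul'])
    (hom_ext fun a v hv => by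
      simp [rescale_apply _ hv, smul_smul])

/-- The right unit isomorphism: `v ⊗ r ↦ ω a 1 1 • r • v` for `v` of degree `a`. -/
noncomputable def rightUnitIso (V : TwistedVect ω) : tensor V (unit ω) ≅ V :=
  isoOfLin (V := tensor V (unit ω)) (W := V)
    (rescale V (fun a => (ω a 1 1 : k)) ∘ₗ (TensorProduct.rid k V.carrier).toLinearMap)
    ((TensorProduct.rid k V.carrier).symm.toLinearMap ∘ₗ
      rescale V (fun a => ((ω a 1 1)⁻¹ : kˣ).val))
    (comm_of_comp (by
      classical
      intro d
      refine tensor_ext (W := unit ω) fun b a v r hv hr => ?_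
      change rescale V _ (TensorProduct.rid k V.carrier
          ((tensor V (unit ω)).proj d (v ⊗ₜ[k] r))) =
        V.proj d (rescale V _ (TensorProduct.rid k V.carrier (v ⊗ₜ[k] r)))
      have hr : IsHomog (V := unit ω) 1 r := isHomog_unit r
      have hp : (tensor V (unit ω)).proj d (v ⊗ₜ[k] r) = if d = b then v ⊗ₜ[k] r else 0 := by
        have := (hv.tmul hr).proj_eq d
        rwa [mul_one] at this
      rw [hp, TensorProduct.rid_tmul, map_smul, rescale_apply _ hv, map_smul, map_smul, hv.proj_eq]
      split_ifs
      · rw [TensorProduct.rid_tmul, map_smul, rescale_apply _ hv]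
      · simp))
    (tensor_ext (W := unit ω) fun b a v r hv hr => by
      simp only [LinearMap.comp_apply, LinearEquiv.coe_coe, TensorProduct.rid_tmul, map_smul,
        rescale_apply _ hv, TensorProduct.rid_symm_apply, LinearMap.id_apply]
      rw [smul_smul, smul_smul, mul_assoc, Units.mul_inv, mul_one, ← TensorProduct.tmul_smul, smul_eq_mul, mul_one])
    (hom_ext fun a v hv => by
      simp [rescale_apply _ hv, smul_smul])

noncomputable instance : MonoidalCategoryStruct (TwistedVect ω) where
  tensorObj V W := tensor V W
  whiskerLeft V _ _ f := tensorMap (𝟙 V) f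
  whiskerRight f W := tensorMap f (𝟙 W)
  tensorHom f g := tensorMap f g
  tensorUnit := unit ω
  associator := assocIso
  leftUnitor := leftUnitIso
  rightUnitor := rightUnitIso

noncomputable instance : MonoidalCategory (TwistedVect ω) where
  tensorHom_def f g := toLin_injective (TensorProduct.ext' fun v w => rfl)
  id_tensorHom_id V W := toLin_injective (TensorProduct.ext' fun v w => rfl)
  tensorHom_comp_tensorHom f g f' g' := toLin_injective (TensorProduct.ext' fun v w => rfl)
  whiskerLeft_id V W := toLin_injective (TensorProduct.ext' fun v w => rfl)
  id_whiskerRight V W := toLin_injective (TensorProduct.ext' fun v w => rfl)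
  associator_naturality {X₁ X₂ X₃ Y₁ Y₂ Y₃} f g h := toLin_injective (by
    refine tensor_ext₃ fun a b c v w x hv hw hx => ?_
    change assocLin Y₁ Y₂ Y₃ ((toLin f v ⊗ₜ toLin g w) ⊗ₜ toLin h x) =
      TensorProduct.map (toLin f) (TensorProduct.map (toLin g) (toLin h))
        (assocLin X₁ X₂ X₃ ((v ⊗ₜ w) ⊗ₜ x))
    rw [assocLin_apply hv hw hx, assocLin_apply (hv.toLin f) (hw.toLin g) (hx.toLin h)]
    simp)
  leftUnitor_naturality {V W} f := toLin_injective (by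
    refine tensor_ext (V := unit ω) fun a b r v hr hv => ?_
    change rescale W _ (TensorProduct.lid k W.carrier (r ⊗ₜ toLin f v)) =
      toLin f (rescale V _ (TensorProduct.lid k V.carrier (r ⊗ₜ v)))
    simp only [TensorProduct.lid_tmul, map_smul, rescale_apply _ hv,
      rescale_apply _ (hv.toLin f)])
  rightUnitor_naturality {V W} f := toLin_injective (by
    refine tensor_ext (W := unit ω) fun b a v r hv hr => ?_
    change rescale W _ (TensorProduct.rid k W.carrier (toLin f v ⊗ₜ r)) =
      toLin f (rescale V _ (TensorProduct.rid k V.carrier (v ⊗ₜ r)))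
    simp only [TensorProduct.rid_tmul, map_smul, rescale_apply _ hv,
      rescale_apply _ (hv.toLin f)])
  pentagon W X Y Z := toLin_injective (by
    refine tensor_ext₄ fun a b c d w x y z hw hx hy hz => ?_
    change TensorProduct.map LinearMap.id (assocLin X Y Z) (assocLin W (tensor X Y) Z
        (TensorProduct.map (assocLin W X Y) LinearMap.id (((w ⊗ₜ x) ⊗ₜ y) ⊗ₜ z))) =
      assocLin W X (tensor Y Z) (assocLin (tensor W X) Y Z (((w ⊗ₜ x) ⊗ₜ y) ⊗ₜ z))
    have key : (ω a b c : k) * ω a (b * c) d * ω b c d = ω (a * b) c d * ω a b (c * d) := by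
      exact_mod_cast congrArg Units.val (ω.cocycle a b c d)
    rw [TensorProduct.map_tmul, assocLin_apply hw hx hy, ← TensorProduct.smul_tmul', map_smul,
      LinearMap.id_apply,
      assocLin_apply (W := tensor X Y) hw (hx.tmul hy) hz, map_smul, map_smul,
      TensorProduct.map_tmul, assocLin_apply hx hy hz,
      assocLin_apply (V := tensor W X) (hw.tmul hx) hy hz, map_smul,
      assocLin_apply (X := tensor Y Z) hw hx (hy.tmul hz), smul_smul, TensorProduct.tmul_smul,
      smul_smul, smul_smul, key]
    rfl)
  triangle V W := toLin_injective (by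
    refine tensor_ext₃ (W := unit ω) fun a b c v r w hv hr hw => ?_
    have hr : IsHomog (V := unit ω) 1 r := isHomog_unit r
    change TensorProduct.map LinearMap.id (rescale W _ ∘ₗ (TensorProduct.lid k W.carrier).toLinearMap)
      (assocLin V (unit ω) W ((v ⊗ₜ r) ⊗ₜ w)) =
      (rescale V _ (TensorProduct.rid k V.carrier (v ⊗ₜ r))) ⊗ₜ w
    rw [assocLin_apply hv hr hw, ω.mid]
    simp [rescale_apply _ hv, rescale_apply _ hw, TensorProduct.smul_tmul', smul_smul]
    congr 2
    have h0 : (ω 1 1 c : k) ≠ 0 := Units.ne_zero _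
    have h1 : ∀ s y z : k, z ≠ 0 → s * z⁻¹ * (y * z) = s * y := by
      intro s y z hz; field_simp
    exact h1 _ _ _ h0)

end TwistedVect

section FusionCategories

attribute [local instance] Abelian.hasFiniteBiproducts

section Simples

variable (C : Type v) [Category.{w} C] [HasZeroMorphisms C]

/-- Isomorphism of simple objects. -/
def simpleSetoid : Setoid {X : C // Simple X} where
  r X Y := Nonempty (X.1 ≅ Y.1)
  iseqv := ⟨fun X => ⟨Iso.refl X.1⟩, fun ⟨e⟩ => ⟨e.symm⟩, fun ⟨e⟩ ⟨e'⟩ => ⟨e.trans e'⟩⟩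

/-- `Irr(C)`: the set of isomorphism classes of simple objects. -/
def Irr : Type v := Quotient (simpleSetoid C)

variable {C}

/-- A chosen simple object in an isomorphism class. -/
noncomputable def Irr.rep (x : Irr C) : C := (Quotient.out x).1

end Simples

/-- A fusion category over `k`: a `k`-linear semisimple rigid tensor category with finitely many
isomorphism classes of simple objects, finite-dimensional spaces of morphisms and simple unit. -/
class IsFusionCategory (k : Type u) [Field k] (C : Type v) [Category.{w} C] [Abelian C]
    [Linear k C] [MonoidalCategory C] [MonoidalPreadditive C] [MonoidalLinear k C]
    [RigidCategory C] : Prop where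
  finiteDimensional_hom : ∀ X Y : C, FiniteDimensional k (X ⟶ Y)
  semisimple : ∀ X : C, ∃ (n : ℕ) (S : Fin n → C), (∀ i, Simple (S i)) ∧ Nonempty (X ≅ ⨁ S)
  finite_irr : Finite (Irr C)
  simple_unit : Simple (𝟙_ C)

section

variable (C : Type v) [Category.{w} C] [Abelian C] [MonoidalCategory C] [RigidCategory C]

variable {C} in
/-- An object is invertible if `X ⊗ X* ≅ 𝟙`. -/
def IsInvertibleObj (X : C) : Prop := Nonempty (X ⊗ Xᘁ ≅ 𝟙_ C)

/-- A fusion category is pointed if all its simple objects are invertible. -/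
def IsPointed : Prop := ∀ X : C, Simple X → IsInvertibleObj X

/-- `G(C)`: the group of isomorphism classes of invertible objects, i.e. the group of units of the
monoid of isomorphism classes of objects under `⊗`. -/
abbrev InvertibleGroup : Type v := (Skeleton C)ˣ

/-- A generalized Tambara–Yamagami category: not pointed, and the tensor product of any two
non-invertible simple objects is a direct sum of invertible objects. -/
def IsGeneralizedTambaraYamagami : Prop :=
  ¬ IsPointed C ∧ ∀ X Y : C, Simple X → Simple Y → ¬ IsInvertibleObj X → ¬ IsInvertibleObj Y →
    ∃ (n : ℕ) (S : Fin n → C), (∀ i, IsInvertibleObj (S i)) ∧ Nonempty (X ⊗ Y ≅ ⨁ S)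

variable {C} in
/-- Fusion subcategories: full subcategories containing the unit and closed under tensor products,
duals, finite direct sums and direct summands (in particular under isomorphisms). -/
structure IsFusionSubcategory (P : ObjectProperty C) : Prop where
  unit : P (𝟙_ C)
  tensor : ∀ X Y : C, P X → P Y → P (X ⊗ Y)
  rightDual : ∀ X : C, P X → P (Xᘁ)
  leftDual : ∀ X : C, P X → P (ᘁX)
  biprod : ∀ X Y : C, P X → P Y → P (X ⊞ Y)
  summand : ∀ X Y : C, P X → Nonempty (Retract Y X) → P Y

/-- `C_ad`: the smallest fusion subcategory containing (the simple summands of) `X ⊗ X*` for all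
simple objects `X`. -/
def adjointSubcategory : ObjectProperty C := fun Y =>
  ∀ P : ObjectProperty C, IsFusionSubcategory P → (∀ X : C, Simple X → P (X ⊗ Xᘁ)) → P Y

end

section UniversalGrading

variable (C : Type v) [Category.{w} C] [Abelian C] [MonoidalCategory C]

/-- The relations `x y = z` for all simple `x`, `y` and all simple constituents `z` of `x ⊗ y`. -/
def gradingRelations : Set (FreeGroup (Irr C)) :=
  {r | ∃ x y z : Irr C, (∃ f : z.rep ⟶ x.rep ⊗ y.rep, f ≠ 0) ∧
    r = FreeGroup.of x * FreeGroup.of y * (FreeGroup.of z)⁻¹}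

/-- The universal grading group `U(C)`: generated by the degrees of the simple objects, subject
only to the relations that hold in every grading of `C`. So every grading of `C` by a group `H`
comes from a unique homomorphism `U(C) → H`. -/
abbrev UniversalGradingGroup : Type v := PresentedGroup (gradingRelations C)

/-- The component of degree `u` of the universal grading: the objects all of whose simple
constituents have degree `u`. -/
def universalComponent (u : UniversalGradingGroup C) : ObjectProperty C := fun X =>
  ∀ z : Irr C, (∃ f : z.rep ⟶ X, f ≠ 0) → PresentedGroup.of z = u

end UniversalGrading

section FrobeniusPerron

variable (k : Type u) [Field k] (C : Type v) [Category.{w} C] [Abelian C] [Linear k C]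
  [MonoidalCategory C]

variable {C} in
/-- The matrix of left multiplication by the class of `X` in the basis `Irr(C)` of the
Grothendieck ring; the multiplicity of a simple `z` in `X ⊗ y` is `dim Hom(z, X ⊗ y)`. -/
noncomputable def fusionMatrix (X : C) : Matrix (Irr C) (Irr C) ℝ := fun z y =>
  (Module.finrank k (z.rep ⟶ X ⊗ y.rep) : ℝ)

variable {C} in
/-- The Frobenius–Perron dimension of `X`: the Frobenius–Perron (i.e. largest real) eigenvalue of
the matrix of left multiplication by `X` (a square matrix indexed by the finite set `Irr(C)`). -/
noncomputable def FPdim (X : C) : ℝ :=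
  sSup {r : ℝ | ∃ v : Irr C → ℝ, v ≠ 0 ∧
    ∀ z : Irr C, ∑ᶠ y : Irr C, fusionMatrix k X z y * v y = r * v z}

/-- `C` is of type `(d₀,n₀; d₁,n₁; …; d_s,n_s)`, where `1 = d₀ < d₁ < ⋯ < d_s` and `n_i ≥ 1`:
the Frobenius–Perron dimensions of the simple objects are the `d_i`, and there are exactly `n_i`
isomorphism classes of simple objects of dimension `d_i`. -/
structure IsOfType {s : ℕ} (d : Fin (s + 1) → ℝ) (n : Fin (s + 1) → ℕ) : Prop where
  zero : d 0 = 1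
  strictMono : StrictMono d
  pos : ∀ i, 0 < n i
  card : ∀ i, Nat.card {x : Irr C // FPdim k x.rep = d i} = n i
  exhaust : ∀ x : Irr C, ∃ i, FPdim k x.rep = d i

end FrobeniusPerron

/-- A grading of a fusion category by a finite group `G`: a decomposition of `C` into a direct sum
of full replete subcategories `C_g` with `C_g ⊗ C_h ⊆ C_{gh}` and `(C_g)* = C_{g⁻¹}`. (The direct
sum decomposition forces every `C_g` to be closed under subobjects, quotients and finite direct
sums, so it is an abelian subcategory.) -/
structure FusionGrading (G : Type t) [Group G] [Finite G] (C : Type v) [Category.{w} C] [Abelian C]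
    [MonoidalCategory C] [RigidCategory C] where
  component : G → ObjectProperty C
  of_iso : ∀ (g : G) (X Y : C), (X ≅ Y) → component g X → component g Y
  decomposition : ∀ X : C, ∃ Y : G → C, (∀ g, component g (Y g)) ∧ Nonempty (X ≅ ⨁ Y)
  hom_eq_zero : ∀ (g h : G), g ≠ h → ∀ (X Y : C), component g X → component h Y →
    ∀ f : X ⟶ Y, f = 0
  tensor : ∀ (g h : G) (X Y : C), component g X → component h Y → component (g * h) (X ⊗ Y)
  dual : ∀ (g : G) (X : C), component g X ↔ component g⁻¹ (Xᘁ)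

namespace FusionGrading

variable {G : Type t} [Group G] [Finite G] {C : Type v} [Category.{w} C] [Abelian C]
  [MonoidalCategory C] [RigidCategory C] (𝒢 : FusionGrading G C)

/-- A grading is faithful if every component is nonzero. -/
def IsFaithful : Prop := ∀ g : G, ∃ X : C, 𝒢.component g X ∧ ¬ IsZero X

theorem unit_mem (h1 : Simple (𝟙_ C)) : 𝒢.component 1 (𝟙_ C) := by
  classical
  obtain ⟨Y, hY, ⟨e⟩⟩ := 𝒢.decomposition (𝟙_ C)
  have hne : ∃ g, biproduct.ι Y g ≫ e.inv ≠ 0 := by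
    by_contra hcon
    push Not at hcon
    have : e.inv = 0 := biproduct.hom_ext' _ _ fun g => by rw [hcon g, comp_zero]
    exact id_nonzero (𝟙_ C) (by rw [← e.hom_inv_id, this, comp_zero])
  obtain ⟨g, hg⟩ := hne
  have : IsIso (biproduct.ι Y g ≫ e.inv) := isIso_of_mono_of_nonzero hg
  have hgu : 𝒢.component g (𝟙_ C) :=
    𝒢.of_iso g _ _ (asIso (biproduct.ι Y g ≫ e.inv)) (hY g)
  have hgg : 𝒢.component (g * g) (𝟙_ C) :=
    𝒢.of_iso _ _ _ (λ_ (𝟙_ C)) (𝒢.tensor g g _ _ hgu hgu)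
  have : g * g = g := by
    by_contra hcon
    exact id_nonzero (𝟙_ C) (𝒢.hom_eq_zero _ _ hcon _ _ hgg hgu _)
  rw [mul_eq_left] at this
  rwa [this] at hgu

theorem isMonoidal (h1 : Simple (𝟙_ C)) : (𝒢.component 1).IsMonoidal where
  prop_unit := 𝒢.unit_mem h1
  prop_tensor X Y hX hY := by simpa using 𝒢.tensor 1 1 X Y hX hY

end FusionGrading

/-- Equivalence of `k`-linear monoidal categories. -/
def TensorEquivalent (k : Type u) [Field k] (D : Type*) [Category* D] [Preadditive D] [Linear k D]
    [MonoidalCategory D] (E : Type*) [Category* E] [Preadditive E] [Linear k E]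
    [MonoidalCategory E] : Prop :=
  ∃ F : D ⥤ E, F.IsEquivalence ∧ F.Additive ∧ F.Linear k ∧ Nonempty F.Monoidal

/-- The grading `𝒢` makes `C` a `G`-extension of `D`: it is faithful and its trivial component is
equivalent to `D`. -/
def FusionGrading.IsExtensionOf {G : Type t} [Group G] [Finite G] {C : Type v} [Category.{w} C]
    [Abelian C] [MonoidalCategory C] [RigidCategory C] (𝒢 : FusionGrading G C)
    (k : Type u) [Field k] [Linear k C] [MonoidalPreadditive C] [MonoidalLinear k C]
    [IsFusionCategory k C]
    (D : Type*) [Category* D] [Preadditive D] [Linear k D] [MonoidalCategory D] : Prop :=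
  haveI := 𝒢.isMonoidal (IsFusionCategory.simple_unit k)
  𝒢.IsFaithful ∧ TensorEquivalent k D (𝒢.component 1).FullSubcategory

end FusionCategories

/-!
Write `1` and `δ` for the two simple objects of the trivial component. For a simple object `X` and
`S ∈ {1, δ}`, rigidity gives `dim Hom(S, X ⊗ X*) = dim Hom(S ⊗ X, X)`, so `X ⊗ X*` is `1` or
`1 ⊕ δ` according to whether `δ ⊗ X` is different from `X` or isomorphic to it: `X` is invertible
exactly when it is not fixed by `δ`. If `X` is fixed, the scalars by which the isomorphisms
`(a ⊗ b) ⊗ X ≅ X` and `a ⊗ (b ⊗ X) ≅ X` differ form a 2-cochain with coboundary `ω`, so a nontrivial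
`ω` leaves no room for non-invertible simple objects.

A non-invertible simple object is alone in its component, as any other simple object of that
component is obtained from it by tensoring with `1` or `δ`. For two of them,
`dim End(X ⊗ Y) = dim Hom(X, X ⊗ (1 ⊕ δ)) = 2`, so `X ⊗ Y` is the sum of two distinct simple objects
of one component, and these are invertible. Hence `1` on invertible and `√2` on non-invertible
simple objects is a positive character of the fusion ring, which is therefore the Frobenius–Perron
dimension. The degree maps the group of invertible objects to `G` with kernel `{1, δ}` and an image
of index two, whose complement indexes the non-invertible simple objects. Finally, `δ ⊗ X ≅ X`
forces `δ` to have degree `1` in every grading, so that the given one is universal.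
-/

attribute [local instance] Abelian.hasFiniteBiproducts

/-! ### Duality and invertible objects -/

section Rigid

variable {C : Type v} [Category.{w} C] [MonoidalCategory C]

section Preadditive

variable [Preadditive C] [MonoidalPreadditive C] {X Y : C} [ExactPairing X Y]

theorem coevaluation_ne_zero (hX : ¬ IsZero X) : η_ X Y ≠ 0 := by
  intro h
  refine hX ((IsZero.iff_id_eq_zero _).2 ?_)
  have zigzag := ExactPairing.evaluation_coevaluation X Y
  rw [h, MonoidalPreadditive.zero_whiskerRight, zero_comp] at zigzag
  rw [← cancel_epi (λ_ X).hom, ← cancel_mono (ρ_ X).inv]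
  simpa using zigzag.symm

theorem evaluation_ne_zero (hX : ¬ IsZero X) : ε_ X Y ≠ 0 := by
  intro h
  refine hX ((IsZero.iff_id_eq_zero _).2 ?_)
  have zigzag := ExactPairing.evaluation_coevaluation X Y
  rw [h, MonoidalPreadditive.whiskerLeft_zero, comp_zero, comp_zero] at zigzag
  rw [← cancel_epi (λ_ X).hom, ← cancel_mono (ρ_ X).inv]
  simpa using zigzag.symm

end Preadditive

theorem isUnit_toSkeleton_iff {X : C} : IsUnit (toSkeleton X) ↔
    ∃ Y : C, Nonempty (X ⊗ Y ≅ 𝟙_ C) ∧ Nonempty (Y ⊗ X ≅ 𝟙_ C) := by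
  simp only [isUnit_iff_exists, ← toSkeleton_eq_toSkeleton_iff, Skeleton.toSkeleton_tensorObj,
    ← Skeleton.one_eq]
  refine ⟨fun ⟨s, hs⟩ => ⟨s.out, ?_⟩, fun ⟨Y, hY⟩ => ⟨toSkeleton Y, hY⟩⟩
  rwa [show toSkeleton s.out = s from Quotient.out_eq s]

theorem isEquivalence_tensorLeft {X : C} (hX : IsUnit (toSkeleton X)) :
    (tensorLeft X).IsEquivalence := by
  obtain ⟨Y, ⟨e⟩, ⟨e'⟩⟩ := isUnit_toSkeleton_iff.1 hX
  exact (CategoryTheory.Equivalence.mk (tensorLeft X) (tensorLeft Y)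
    ((leftUnitorNatIso C).symm ≪≫ (tensoringLeft C).mapIso e'.symm ≪≫ tensorLeftTensor Y X)
    ((tensorLeftTensor X Y).symm ≪≫ (tensoringLeft C).mapIso e ≪≫
      leftUnitorNatIso C)).isEquivalence_functor

theorem isEquivalence_tensorRight {X : C} (hX : IsUnit (toSkeleton X)) :
    (tensorRight X).IsEquivalence := by
  obtain ⟨Y, ⟨e⟩, ⟨e'⟩⟩ := isUnit_toSkeleton_iff.1 hX
  exact (CategoryTheory.Equivalence.mk (tensorRight X) (tensorRight Y)
    ((rightUnitorNatIso C).symm ≪≫ (tensoringRight C).mapIso e.symm ≪≫ tensorRightTensor X Y)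
    ((tensorRightTensor Y X).symm ≪≫ (tensoringRight C).mapIso e' ≪≫
      rightUnitorNatIso C)).isEquivalence_functor

section ZeroMorphisms

variable [HasZeroMorphisms C]

theorem simple_tensor_of_isUnit_left {X : C} (hX : IsUnit (toSkeleton X)) (Y : C) [Simple Y] :
    Simple (X ⊗ Y) :=
  have := isEquivalence_tensorLeft hX
  simple_obj (tensorLeft X) Y

theorem simple_tensor_of_isUnit_right {X : C} (hX : IsUnit (toSkeleton X)) (Y : C) [Simple Y] :
    Simple (Y ⊗ X) :=
  have := isEquivalence_tensorRight hX
  simple_obj (tensorRight X) Y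

theorem simple_of_isUnit {X : C} (hX : IsUnit (toSkeleton X)) [Simple (𝟙_ C)] : Simple X :=
  have := simple_tensor_of_isUnit_left hX (𝟙_ C)
  Simple.of_iso (ρ_ X).symm

end ZeroMorphisms

section Abelian

variable [Abelian C] [MonoidalPreadditive C] [RigidCategory C] [Simple (𝟙_ C)]

theorem faithful_tensorLeft {X : C} (hX : ¬ IsZero X) : (tensorLeft X).Faithful where
  map_injective {A B f g} h := by
    have : Epi (ε_ X (Xᘁ)) := epi_of_nonzero_to_simple (evaluation_ne_zero hX)
    have := (tensorRightAdjunction A (Aᘁ)).isLeftAdjoint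
    have : Epi (ε_ X (Xᘁ) ▷ A) := inferInstanceAs (Epi ((tensorRight A).map (ε_ X (Xᘁ))))
    have key : (Xᘁ ⊗ X) ◁ f = (Xᘁ ⊗ X) ◁ g := by
      rw [tensor_whiskerLeft, tensor_whiskerLeft, show X ◁ f = X ◁ g from h]
    rw [← cancel_epi (λ_ A).hom, ← cancel_epi (ε_ X (Xᘁ) ▷ A), ← leftUnitor_naturality,
      ← leftUnitor_naturality, ← whisker_exchange_assoc, ← whisker_exchange_assoc, key]

theorem not_isZero_tensor {X Y : C} (hX : ¬ IsZero X) (hY : ¬ IsZero Y) : ¬ IsZero (X ⊗ Y) := by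
  have := faithful_tensorLeft hX
  intro h
  refine hY ((IsZero.iff_id_eq_zero Y).2 ((tensorLeft X).map_injective ?_))
  exact h.eq_of_src _ _

theorem isInvertibleObj_iff_isUnit {X : C} : IsInvertibleObj X ↔ IsUnit (toSkeleton X) := by
  constructor
  · rintro ⟨e⟩
    have hX : ¬ IsZero X := fun h =>
      Simple.not_isZero (𝟙_ C) (((tensorRight (Xᘁ)).map_isZero h).of_iso e.symm)
    have : Simple (X ⊗ Xᘁ) := Simple.of_iso e
    have : IsIso (η_ X (Xᘁ)) := isIso_of_hom_simple (coevaluation_ne_zero hX)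
    have : IsIso ((tensorLeft X).map (ε_ X (Xᘁ))) := by
      have zigzag := ExactPairing.evaluation_coevaluation X (Xᘁ)
      rw [← IsIso.eq_inv_comp, ← IsIso.eq_inv_comp] at zigzag
      rw [show (tensorLeft X).map (ε_ X (Xᘁ)) = _ from zigzag]
      infer_instance
    have := faithful_tensorLeft hX
    have : IsIso (ε_ X (Xᘁ)) := isIso_of_reflects_iso (ε_ X (Xᘁ)) (tensorLeft X)
    exact isUnit_toSkeleton_iff.2 ⟨Xᘁ, ⟨e⟩, ⟨asIso (ε_ X (Xᘁ))⟩⟩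
  · intro hX
    have := isEquivalence_tensorLeft hX
    let adj := tensorLeftAdjunction X (Xᘁ)
    have := adj.isEquivalence_left_of_isEquivalence_right
    exact ⟨whiskerLeftIso X (ρ_ (Xᘁ)).symm ≪≫ (asIso (adj.unit.app (𝟙_ C))).symm⟩

end Abelian

end Rigid

/-! ### Simple objects and dimensions of morphism spaces -/

section Irr

variable {C : Type v} [Category.{w} C] [HasZeroMorphisms C]

instance Irr.simple_rep (x : Irr C) : Simple x.rep := (Quotient.out x).2

/-- The isomorphism class of a simple object, as an element of `Irr C`. -/
def Irr.mk (X : C) [Simple X] : Irr C := Quotient.mk (simpleSetoid C) ⟨X, inferInstance⟩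

theorem Irr.mk_eq_mk_iff {X Y : C} [Simple X] [Simple Y] :
    Irr.mk X = Irr.mk Y ↔ toSkeleton X = toSkeleton Y := by
  rw [toSkeleton_eq_toSkeleton_iff]
  exact Quotient.eq (r := simpleSetoid C)

theorem Irr.mk_rep (x : Irr C) : Irr.mk x.rep = x := Quotient.out_eq x

theorem Irr.toSkeleton_rep_mk (X : C) [Simple X] : toSkeleton (Irr.mk X).rep = toSkeleton X := by
  rw [← Irr.mk_eq_mk_iff, Irr.mk_rep]

theorem Irr.nonempty_rep_mk_iso (X : C) [Simple X] : Nonempty ((Irr.mk X).rep ≅ X) :=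
  toSkeleton_eq_toSkeleton_iff.1 (Irr.toSkeleton_rep_mk X)

end Irr

section HomDimension

variable (k : Type u) [Field k] {C : Type v} [Category.{w} C]

section Preadditive

variable [Preadditive C] [Linear k C]

theorem finrank_hom_congr {X X' Y Y' : C} (e : X ≅ X') (e' : Y ≅ Y') :
    Module.finrank k (X ⟶ Y) = Module.finrank k (X' ⟶ Y') :=
  (Linear.homCongr k e e').finrank_eq

variable [MonoidalCategory C] [MonoidalPreadditive C] [MonoidalLinear k C]

theorem finrank_tensorRight_hom (X Y Y' Z : C) [ExactPairing Y Y'] :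
    Module.finrank k (X ⊗ Y ⟶ Z) = Module.finrank k (X ⟶ Z ⊗ Y') :=
  LinearEquiv.finrank_eq
    { tensorRightHomEquiv X Y Y' Z with
      map_add' := fun f g => by simp [tensorRightHomEquiv, MonoidalPreadditive.add_whiskerRight]
      map_smul' := fun c f => by simp [tensorRightHomEquiv, MonoidalLinear.smul_whiskerRight] }

end Preadditive

variable [Abelian C] [Linear k C]

/-- The isomorphism between morphisms into a finite biproduct and families of morphisms. -/
noncomputable def homBiproductEquiv {J : Type*} [Finite J] (X : C) (S : J → C) :
    (X ⟶ ⨁ S) ≃ₗ[k] ∀ j, (X ⟶ S j) where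
  toFun f j := f ≫ biproduct.π S j
  invFun f := biproduct.lift f
  map_add' f g := by ext; simp
  map_smul' c f := by ext; simp
  left_inv f := by ext; simp
  right_inv f := by ext; simp

/-- The isomorphism between morphisms out of a finite biproduct and families of morphisms. -/
noncomputable def biproductHomEquiv {J : Type*} [Finite J] (S : J → C) (X : C) :
    ((⨁ S) ⟶ X) ≃ₗ[k] ∀ j, (S j ⟶ X) where
  toFun f j := biproduct.ι S j ≫ f
  invFun f := biproduct.desc f
  map_add' f g := by ext; simp
  map_smul' c f := by ext; simp
  left_inv f := by ext; simp
  right_inv f := by ext; simp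

variable [∀ X Y : C, FiniteDimensional k (X ⟶ Y)]

theorem finrank_hom_biproduct {J : Type*} [Fintype J] (X : C) (S : J → C) :
    Module.finrank k (X ⟶ ⨁ S) = ∑ j, Module.finrank k (X ⟶ S j) := by
  rw [(homBiproductEquiv k X S).finrank_eq, Module.finrank_pi_fintype]

theorem finrank_biproduct_hom {J : Type*} [Fintype J] (S : J → C) (X : C) :
    Module.finrank k ((⨁ S) ⟶ X) = ∑ j, Module.finrank k (S j ⟶ X) := by
  rw [(biproductHomEquiv k S X).finrank_eq, Module.finrank_pi_fintype]

variable [IsAlgClosed k]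

open Classical in
theorem finrank_hom_simple (X Y : C) [Simple X] [Simple Y] :
    Module.finrank k (X ⟶ Y) = if toSkeleton X = toSkeleton Y then 1 else 0 := by
  rw [finrank_hom_simple_simple, toSkeleton_eq_toSkeleton_iff]

theorem finrank_rep_hom_biproduct {J : Type*} [Finite J] (S : J → C) [∀ j, Simple (S j)]
    (x : Irr C) : Module.finrank k (x.rep ⟶ ⨁ S) = Nat.card {j // Irr.mk (S j) = x} := by
  classical
  have := Fintype.ofFinite J
  rw [finrank_hom_biproduct, Nat.card_eq_fintype_card, Fintype.card_subtype,
    Finset.card_filter]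
  refine Finset.sum_congr rfl fun j _ => ?_
  rw [finrank_hom_simple, ← Irr.mk_eq_mk_iff, Irr.mk_rep]
  simp only [eq_comm]

theorem finrank_hom_tensor_rightDual [MonoidalCategory C] [MonoidalPreadditive C]
    [MonoidalLinear k C] [RightRigidCategory C] {S : C} (hS : IsUnit (toSkeleton S)) (X : C)
    [Simple X] [Decidable (toSkeleton S * toSkeleton X = toSkeleton X)] :
    Module.finrank k (S ⟶ X ⊗ Xᘁ) =
      if toSkeleton S * toSkeleton X = toSkeleton X then 1 else 0 := by
  have := simple_tensor_of_isUnit_left hS X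
  rw [← finrank_tensorRight_hom k S X (Xᘁ) X, finrank_hom_simple, Skeleton.toSkeleton_tensorObj]
  congr

end HomDimension

section Semisimple

attribute [local instance] IsFusionCategory.finiteDimensional_hom

variable (k : Type u) [Field k] {C : Type v} [Category.{w} C] [Abelian C] [Linear k C]
  [MonoidalCategory C] [MonoidalPreadditive C] [MonoidalLinear k C] [RigidCategory C]
  [IsFusionCategory k C]

include k

theorem exists_rep_hom_ne_zero {X : C} (hX : ¬ IsZero X) :
    ∃ (z : Irr C) (f : z.rep ⟶ X), f ≠ 0 := by
  obtain ⟨n, S, hS, ⟨e⟩⟩ := IsFusionCategory.semisimple k X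
  by_contra! h
  have hS_hom (i : Fin n) (f : S i ⟶ X) : f = 0 := by
    obtain ⟨e'⟩ := Irr.nonempty_rep_mk_iso (S i)
    exact Preadditive.IsIso.comp_left_eq_zero e'.hom f |>.1 (h _ _)
  have h0 : e.inv = 0 := biproduct.hom_ext' _ _ fun i => (hS_hom i _).trans comp_zero.symm
  exact hX ((IsZero.iff_id_eq_zero _).2 (by rw [← e.hom_inv_id, h0, comp_zero]))

variable [IsAlgClosed k]

theorem nonempty_iso_of_finrank_hom_eq {X Y : C}
    (h : ∀ z : Irr C, Module.finrank k (z.rep ⟶ X) = Module.finrank k (z.rep ⟶ Y)) :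
    Nonempty (X ≅ Y) := by
  obtain ⟨m, S, hS, ⟨e⟩⟩ := IsFusionCategory.semisimple k X
  obtain ⟨n, T, hT, ⟨e'⟩⟩ := IsFusionCategory.semisimple k Y
  have card_eq (x : Irr C) :
      Nat.card {i // Irr.mk (S i) = x} = Nat.card {j // Irr.mk (T j) = x} := by
    rw [← finrank_rep_hom_biproduct k, ← finrank_rep_hom_biproduct k,
      ← finrank_hom_congr k (Iso.refl _) e, ← finrank_hom_congr k (Iso.refl _) e']
    exact h x
  let σ : Fin m ≃ Fin n := Equiv.ofFiberEquiv (f := fun i => Irr.mk (S i))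
    (g := fun j => Irr.mk (T j)) fun x => (Finite.card_eq.1 (card_eq x)).some
  have hσ (i : Fin m) : Nonempty (T (σ i) ≅ S i) := by
    rw [← toSkeleton_eq_toSkeleton_iff, ← Irr.mk_eq_mk_iff]
    exact Equiv.ofFiberEquiv_map (g := fun j => Irr.mk (T j)) _ i
  exact ⟨e ≪≫ biproduct.whiskerEquiv σ (fun i => (hσ i).some) ≪≫ e'.symm⟩

theorem exists_iso_biproduct_of_finrank_end_eq_two {X : C} (h : Module.finrank k (X ⟶ X) = 2) :
    ∃ S : Fin 2 → C, (∀ i, Simple (S i)) ∧ toSkeleton (S 0) ≠ toSkeleton (S 1) ∧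
      Nonempty (X ≅ ⨁ S) := by
  classical
  obtain ⟨n, S, hS, ⟨e⟩⟩ := IsFusionCategory.semisimple k X
  simp only [finrank_hom_congr k e e, finrank_hom_biproduct, finrank_biproduct_hom,
    finrank_hom_simple] at h
  have hn : n ≤ 2 := by
    calc n = ∑ _i : Fin n, 1 := by simp
      _ ≤ ∑ i, ∑ j, if toSkeleton (S j) = toSkeleton (S i) then 1 else 0 := by
        refine Finset.sum_le_sum fun i _ => ?_
        simpa using Finset.single_le_sum (f := fun j =>
          if toSkeleton (S j) = toSkeleton (S i) then 1 else 0) (fun _ _ => Nat.zero_le _)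
          (Finset.mem_univ i)
      _ = 2 := h
  interval_cases n
  · simp at h
  · simp [-Finset.sum_boole] at h
  · refine ⟨S, hS, fun h01 => ?_, ⟨e⟩⟩
    simp [Fin.sum_univ_two, h01, -Finset.sum_boole] at h

end Semisimple

/-! ### Frobenius–Perron dimensions -/

section PerronFrobenius

open scoped Matrix

variable {ι : Type*} [Fintype ι]

theorem exists_mulVec_eq_smul_iff_exists_vecMul_eq_smul {K : Type*} [CommRing K] [IsDomain K]
    (M : Matrix ι ι K) (r : K) :
    (∃ v, v ≠ 0 ∧ M *ᵥ v = r • v) ↔ ∃ v, v ≠ 0 ∧ v ᵥ* M = r • v := by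
  classical
  have h := (Matrix.exists_mulVec_eq_zero_iff (M := M - Matrix.scalar ι r)).trans
    Matrix.exists_vecMul_eq_zero_iff.symm
  simpa only [Matrix.sub_mulVec, Matrix.vecMul_sub, Matrix.scalar_apply, sub_eq_zero,
    ← Matrix.smul_one_eq_diagonal, Matrix.smul_mulVec, Matrix.vecMul_smul, Matrix.one_mulVec,
    Matrix.vecMul_one] using h

theorem le_of_mulVec_eq_smul_of_vecMul_eq_smul {M : Matrix ι ι ℝ} (hM : ∀ i j, 0 ≤ M i j)
    {d : ι → ℝ} (hd : ∀ i, 0 < d i) {r s : ℝ} (hdM : d ᵥ* M = r • d) {v : ι → ℝ} (hv : v ≠ 0)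
    (hMv : M *ᵥ v = s • v) : s ≤ r := by
  have hpos : 0 < d ⬝ᵥ |v| := by
    obtain ⟨i, hi⟩ := Function.ne_iff.1 hv
    exact Finset.sum_pos' (fun j _ => mul_nonneg (hd j).le (abs_nonneg _))
      ⟨i, Finset.mem_univ i, mul_pos (hd i) (abs_pos.2 hi)⟩
  have hle : s • |v| ≤ M *ᵥ |v| := fun i =>
    calc s * |v i| ≤ |s * v i| := by
          rw [abs_mul]; exact mul_le_mul_of_nonneg_right (le_abs_self s) (abs_nonneg _)
      _ = |∑ j, M i j * v j| := congrArg abs (congrFun hMv i).symm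
      _ ≤ ∑ j, |M i j * v j| := Finset.abs_sum_le_sum_abs _ _
      _ = (M *ᵥ |v|) i := Finset.sum_congr rfl fun j _ => by
          rw [abs_mul, abs_of_nonneg (hM i j), Pi.abs_apply]
  refine le_of_mul_le_mul_right ?_ hpos
  calc s * (d ⬝ᵥ |v|) = d ⬝ᵥ (s • |v|) := by rw [dotProduct_smul, smul_eq_mul]
    _ ≤ d ⬝ᵥ (M *ᵥ |v|) := dotProduct_le_dotProduct_of_nonneg_left hle fun i => (hd i).le
    _ = r * (d ⬝ᵥ |v|) := by rw [Matrix.dotProduct_mulVec, hdM, smul_dotProduct, smul_eq_mul]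

theorem isGreatest_of_vecMul_eq_smul [Nonempty ι] {M : Matrix ι ι ℝ} (hM : ∀ i j, 0 ≤ M i j)
    {d : ι → ℝ} (hd : ∀ i, 0 < d i) {r : ℝ} (hdM : d ᵥ* M = r • d) :
    IsGreatest {s | ∃ v, v ≠ 0 ∧ M *ᵥ v = s • v} r := by
  constructor
  · refine (exists_mulVec_eq_smul_iff_exists_vecMul_eq_smul M r).2 ⟨d, fun h => ?_, hdM⟩
    exact (hd (Classical.arbitrary ι)).ne' (congrFun h _)
  · rintro s ⟨v, hv, hMv⟩
    exact le_of_mulVec_eq_smul_of_vecMul_eq_smul hM hd hdM hv hMv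

theorem FPdim_eq_of_pos (k : Type u) [Field k] {C : Type v} [Category.{w} C] [Abelian C]
    [Linear k C] [MonoidalCategory C] [Fintype (Irr C)] [Nonempty (Irr C)] {X : C}
    {d : Irr C → ℝ} (hd : ∀ z, 0 < d z) {r : ℝ}
    (h : ∀ y : Irr C, ∑ z : Irr C, d z * (Module.finrank k (z.rep ⟶ X ⊗ y.rep) : ℝ) = r * d y) :
    FPdim k X = r := by
  have hgreatest := isGreatest_of_vecMul_eq_smul (M := fusionMatrix k X)
    (fun _ _ => Nat.cast_nonneg _) hd (funext h)
  simp only [FPdim, finsum_eq_sum_of_fintype, ← hgreatest.csSup_eq, funext_iff]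
  rfl

end PerronFrobenius

/-! ### The lines of `Vec_Γ^ω` and fixed objects -/

namespace TwistedVect

variable {Γ : Type v} [Group Γ] [Fintype Γ] {k : Type u} [Field k] {ω : ThreeCocycle Γ k}

open Classical in
/-- The one-dimensional graded vector space concentrated in degree `a`. -/
noncomputable abbrev line (ω : ThreeCocycle Γ k) (a : Γ) : TwistedVect ω where
  carrier := k
  proj b := if b = a then 1 else 0
  isComplete := by
    rw [CompleteOrthogonalIdempotents.iff_ortho_complete]
    constructor
    · intro b c hbc
      by_cases hb : b = a
      · have hc : ¬ c = a := fun h => hbc (hb.trans h.symm)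
        simp [hc]
      · simp [hb]
    · simp

theorem isHomog_line (a : Γ) (c : k) : IsHomog (V := line ω a) a c := by
  simp only [IsHomog, line, if_true]
  rfl

/-- Multiplication of scalars as an isomorphism of lines. -/
noncomputable def lineMul {a b c : Γ} (h : a * b = c) : line ω a ⊗ line ω b ≅ line ω c :=
  isoOfLin (V := tensor (line ω a) (line ω b)) (W := line ω c)
    (TensorProduct.lid k k).toLinearMap (TensorProduct.lid k k).symm.toLinearMap
    (comm_of_comp (V := tensor (line ω a) (line ω b)) (W := line ω c) (by
      classical
      intro d
      refine tensor_ext (V := line ω a) (W := line ω b) (M := k) fun a' b' v w _ _ => ?_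
      have hsource := tensorProj_apply (isHomog_line (ω := ω) a v) (isHomog_line (ω := ω) b w) d
      have htarget := (isHomog_line (ω := ω) c (TensorProduct.lid k k (v ⊗ₜ w))).proj_eq d
      refine (congrArg (TensorProduct.lid k k) hsource).trans (Eq.trans ?_ htarget.symm)
      rw [h]
      split_ifs
      · rfl
      · exact map_zero _))
    (LinearEquiv.symm_comp _) (LinearEquiv.comp_symm _)

theorem lineMul_assoc {a b c ab bc abc : Γ} (hab : a * b = ab) (hbc : b * c = bc)
    (h : ab * c = abc) (h' : a * bc = abc) :
    (ω a b c : k) • ((lineMul (ω := ω) hab).hom ▷ line ω c ≫ (lineMul h).hom) =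
      (α_ _ _ _).hom ≫ line ω a ◁ (lineMul hbc).hom ≫ (lineMul h').hom := by
  apply toLin_injective
  refine tensor_ext₃ (V := line ω a) (W := line ω b) (X := line ω c) fun a' b' c' v w x _ _ _ => ?_
  change (ω a b c : k) • TensorProduct.lid k k (TensorProduct.lid k k (v ⊗ₜ w) ⊗ₜ x) =
    TensorProduct.lid k k (TensorProduct.map LinearMap.id (TensorProduct.lid k k).toLinearMap
      (assocLin (line ω a) (line ω b) (line ω c) ((v ⊗ₜ w) ⊗ₜ x)))
  rw [assocLin_apply (isHomog_line (ω := ω) a v) (isHomog_line b w) (isHomog_line c x), map_smul,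
    map_smul]
  congr 1
  exact mul_assoc v w x

theorem line_hom_eq_zero {a b : Γ} (hab : a ≠ b) (f : line ω a ⟶ line ω b) : f = 0 := by
  classical
  apply toLin_injective
  refine hom_ext fun c v _ => ?_
  have hdeg_a : IsHomog a (toLin f v) := (isHomog_line a v).toLin f
  have hdeg_b := (isHomog_line (ω := ω) b (toLin f v)).proj_eq a
  rw [if_neg hab] at hdeg_b
  exact hdeg_a.symm.trans hdeg_b

theorem exists_line_hom_ne_zero (V : TwistedVect ω) (hV : 𝟙 V ≠ 0) :
    ∃ (a : Γ) (f : line ω a ⟶ V), f ≠ 0 := by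
  obtain ⟨a, v, hv, hv0⟩ : ∃ (a : Γ) (v : V.carrier), IsHomog a v ∧ v ≠ 0 := by
    by_contra! h
    exact hV (toLin_injective (hom_ext fun a v hv => by rw [h a v hv, map_zero, map_zero]))
  refine ⟨a, ofHomog (V := line ω a) (LinearMap.toSpanSingleton k V.carrier v) ?_, fun h => ?_⟩
  · classical
    intro b c hc
    by_cases hb : b = a
    · subst hb
      exact hv.smul c
    · have hzero := (isHomog_line (ω := ω) a c).proj_eq b
      rw [if_neg hb] at hzero
      obtain rfl : c = 0 := hc.symm.trans hzero
      exact (congrArg (V.proj b) (map_zero _)).trans ((map_zero _).trans (map_zero _).symm)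
  · have hv1 := DFunLike.congr_fun (congrArg toLin h) (1 : k)
    exact hv0 ((one_smul k v).symm.trans hv1)

end TwistedVect

/-- Objects of `C` indexed by `Γ` which multiply like the lines of `Vec_Γ^ω`, that is, with
associativity constraint `ω`. The product is indexed by proofs of `a * b = c` rather than by pairs
`a`, `b`, so that no object has to be transported along an equality in `Γ`. -/
structure TwistedSystem {Γ : Type t} [Group Γ] {k : Type u} [Field k] (ω : ThreeCocycle Γ k)
    (C : Type v) [Category.{w} C] [Preadditive C] [Linear k C] [MonoidalCategory C] where
  obj : Γ → C
  one : 𝟙_ C ≅ obj 1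
  mul {a b c : Γ} : a * b = c → (obj a ⊗ obj b ≅ obj c)
  mul_assoc {a b c ab bc abc : Γ} (hab : a * b = ab) (hbc : b * c = bc) (h : ab * c = abc)
    (h' : a * bc = abc) : (ω a b c : k) • ((mul hab).hom ▷ obj c ≫ (mul h).hom) =
      (α_ _ _ _).hom ≫ obj a ◁ (mul hbc).hom ≫ (mul h').hom

/-- The lines of `Vec_Γ^ω` as a twisted system. -/
noncomputable def TwistedVect.lines {Γ : Type t} [Group Γ] [Fintype Γ] {k : Type u} [Field k]
    (ω : ThreeCocycle Γ k) : TwistedSystem ω (TwistedVect ω) where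
  obj := line ω
  one := Iso.refl _
  mul := lineMul
  mul_assoc := lineMul_assoc

section ScalarEndomorphisms

variable {k : Type u} [Field k] {C : Type v} [Category.{w} C] [Preadditive C] [Linear k C] {X : C}

theorem smul_iso_hom_injective (hX : 𝟙 X ≠ 0) {W : C} (e : W ≅ X) :
    Function.Injective fun c : k => c • e.hom := by
  have he : e.hom ≠ 0 := fun h => hX (by rw [← e.inv_hom_id, h, comp_zero])
  exact smul_left_injective k he

theorem exists_units_smul_eq_of_scalar_end (hend : ∀ f : X ⟶ X, ∃ c : k, c • 𝟙 X = f)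
    (hX : 𝟙 X ≠ 0) {W : C} (e e' : W ≅ X) : ∃ c : kˣ, e'.hom = (c : k) • e.hom := by
  obtain ⟨c, hc⟩ := hend (e.inv ≫ e'.hom)
  have he' : e'.hom = c • e.hom := by
    rw [← cancel_epi e.inv, ← hc, Linear.comp_smul, e.inv_hom_id]
  refine ⟨Units.mk0 c ?_, he'⟩
  rintro rfl
  exact hX (by rw [← e'.inv_hom_id, he', zero_smul, comp_zero])

end ScalarEndomorphisms

namespace TwistedSystem

variable {Γ : Type t} [Group Γ] {k : Type u} [Field k] {ω : ThreeCocycle Γ k} {C : Type v}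
  [Category.{w} C] [Preadditive C] [Linear k C] [MonoidalCategory C]

open Functor.LaxMonoidal Functor.Monoidal in
/-- The image of a twisted system under a linear monoidal functor. -/
noncomputable def map {D : Type*} [Category* D] [Preadditive D] [Linear k D] [MonoidalCategory D]
    (A : TwistedSystem ω D) (F : D ⥤ C) [F.Monoidal] [F.Linear k] :
    TwistedSystem ω C where
  obj a := F.obj (A.obj a)
  one := εIso F ≪≫ F.mapIso A.one
  mul h := μIso F _ _ ≪≫ F.mapIso (A.mul h)
  mul_assoc hab hbc h h' := by
    have key := congrArg F.map (A.mul_assoc hab hbc h h')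
    simp only [F.map_smul, F.map_comp] at key
    simp only [Iso.trans_hom, μIso_hom, Functor.mapIso_hom, comp_whiskerRight, Category.assoc,
      μ_natural_left_assoc, MonoidalCategory.whiskerLeft_comp, μ_natural_right_assoc]
    rw [← associativity_assoc, ← key]
    simp only [Linear.comp_smul]

variable (A : TwistedSystem ω C)

/-- The classes of the objects of a twisted system; they do not see `ω`. -/
noncomputable def classHom : Γ →* Skeleton C where
  toFun a := toSkeleton (A.obj a)
  map_one' := (congr_toSkeleton_of_iso A.one).symm
  map_mul' a b := by
    rw [← Skeleton.toSkeleton_tensorObj]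
    exact (congr_toSkeleton_of_iso (A.mul rfl)).symm

theorem isUnit_toSkeleton_obj (a : Γ) : IsUnit (toSkeleton (A.obj a)) :=
  (Group.isUnit a).map A.classHom

section Fixed

variable {A} {X : C} (φ : ∀ a, A.obj a ⊗ X ≅ X)

/-- Given isomorphisms `A a ⊗ X ≅ X`, the isomorphism obtained by absorbing `A b`, then `A a`. -/
def absorbTwo (a b : Γ) : (A.obj a ⊗ A.obj b) ⊗ X ≅ X :=
  α_ _ _ _ ≪≫ whiskerLeftIso (A.obj a) (φ b) ≪≫ φ a

/-- Given isomorphisms `A a ⊗ X ≅ X`, the isomorphism obtained by absorbing `A c`, then `A b`, then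
`A a`. -/
def absorbThree (a b c : Γ) : ((A.obj a ⊗ A.obj b) ⊗ A.obj c) ⊗ X ≅ X :=
  α_ _ _ _ ≪≫ whiskerLeftIso (A.obj a ⊗ A.obj b) (φ c) ≪≫ absorbTwo φ a b

variable {φ} {η : Γ → Γ → k}
  (hη : ∀ {a b ab : Γ} (h : a * b = ab),
    (A.mul h).hom ▷ X ≫ (φ ab).hom = η a b • (absorbTwo φ a b).hom)

include hη

theorem mul_mul_whiskerRight_comp {a b c ab abc : Γ} (hab : a * b = ab) (h : ab * c = abc) :
    ((A.mul hab).hom ▷ A.obj c ≫ (A.mul h).hom) ▷ X ≫ (φ abc).hom =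
      (η ab c * η a b) • (absorbThree φ a b c).hom := by
  simp only [comp_whiskerRight, Category.assoc, hη h, Linear.comp_smul, absorbTwo, Iso.trans_hom,
    whiskerLeftIso_hom, associator_naturality_left_assoc]
  rw [← whisker_exchange_assoc, hη hab]
  simp [absorbThree, smul_smul]

variable [MonoidalPreadditive C] [MonoidalLinear k C]

theorem whiskerLeft_mul_whiskerRight_comp {a b c bc abc : Γ} (hbc : b * c = bc)
    (h : a * bc = abc) :
    ((α_ _ _ _).hom ≫ A.obj a ◁ (A.mul hbc).hom ≫ (A.mul h).hom) ▷ X ≫ (φ abc).hom =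
      (η a bc * η b c) • (absorbThree φ a b c).hom := by
  simp only [comp_whiskerRight, Category.assoc, hη h, Linear.comp_smul]
  simp only [absorbTwo, Iso.trans_hom, whiskerLeftIso_hom, associator_naturality_middle_assoc]
  rw [← whiskerLeft_comp_assoc, hη hbc]
  simp [absorbThree, absorbTwo, smul_smul]

omit hη in
theorem isTrivial_of_fixed (hend : ∀ f : X ⟶ X, ∃ c : k, c • 𝟙 X = f) (hX : 𝟙 X ≠ 0)
    (φ : ∀ a, A.obj a ⊗ X ≅ X) : ω.IsTrivial := by
  have exists_scalar (a b : Γ) := exists_units_smul_eq_of_scalar_end hend hX (absorbTwo φ a b)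
    (whiskerRightIso (A.mul rfl) X ≪≫ φ (a * b))
  choose η hη₀ using exists_scalar
  have hη {a b ab : Γ} (h : a * b = ab) :
      (A.mul h).hom ▷ X ≫ (φ ab).hom = (η a b : k) • (absorbTwo φ a b).hom := by
    subst h
    exact hη₀ a b
  refine ⟨η, fun a b c => ?_⟩
  have hcoboundary : ω a b c * (η (a * b) c * η a b) = η a (b * c) * η b c := by
    ext
    push_cast
    refine smul_iso_hom_injective hX (absorbThree φ a b c) ?_
    have hassoc := congrArg (fun f => f ▷ X ≫ (φ (a * b * c)).hom)
      (A.mul_assoc (a := a) (b := b) (c := c) rfl rfl rfl (_root_.mul_assoc a b c).symm)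
    simp only [MonoidalLinear.smul_whiskerRight, Linear.smul_comp,
      whiskerLeft_mul_whiskerRight_comp hη, mul_mul_whiskerRight_comp hη, smul_smul] at hassoc
    exact hassoc
  rw [eq_mul_inv_of_mul_eq hcoboundary, mul_inv]
  simp only [_root_.mul_assoc, mul_comm, mul_left_comm]

end Fixed

end TwistedSystem

/-! ### Fusion subcategories and gradings -/

namespace IsFusionSubcategory

variable {C : Type v} [Category.{w} C] [Abelian C] [MonoidalCategory C] [RigidCategory C]
  {P : ObjectProperty C}

theorem of_iso (hP : IsFusionSubcategory P) {X Y : C} (e : X ≅ Y) (hX : P X) : P Y :=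
  hP.summand _ _ hX ⟨⟨e.inv, e.hom, e.inv_hom_id⟩⟩

theorem biproduct (hP : IsFusionSubcategory P) {n : ℕ} {S : Fin n → C} (hS : ∀ i, P (S i)) :
    P (⨁ S) := by
  induction n with
  | zero => exact hP.summand _ _ hP.unit ⟨⟨0, 0, biproduct.hom_ext _ _ fun i => i.elim0⟩⟩
  | succ n ih =>
    refine hP.summand _ _ (hP.biprod _ _ (hS 0) (ih fun i => hS i.succ)) ⟨⟨
      biprod.lift (biproduct.π S 0) (biproduct.lift fun i => biproduct.π S i.succ),
      biprod.desc (biproduct.ι S 0) (biproduct.desc fun i => biproduct.ι S i.succ), ?_⟩⟩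
    rw [biprod.lift_desc, biproduct.lift_desc, ← biproduct.total, Fin.sum_univ_succ]

end IsFusionSubcategory

namespace FusionGrading

variable {G : Type t} [Group G] [Finite G] {C : Type v} [Category.{w} C] [Abelian C]
  [MonoidalCategory C] [RigidCategory C] (𝒢 : FusionGrading G C)

theorem component_iff_hom_eq_zero (g : G) (X : C) : 𝒢.component g X ↔
    ∀ h, h ≠ g → ∀ Y, 𝒢.component h Y → ∀ f : Y ⟶ X, f = 0 := by
  classical
  refine ⟨fun hX h hh Y hY f => 𝒢.hom_eq_zero h g hh Y X hY hX f, fun H => ?_⟩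
  obtain ⟨Y, hY, ⟨e⟩⟩ := 𝒢.decomposition X
  have hι (h : G) (hh : h ≠ g) : biproduct.ι Y h = 0 := by
    have hzero := H h hh _ (hY h) (biproduct.ι Y h ≫ e.inv)
    rwa [Preadditive.IsIso.comp_right_eq_zero] at hzero
  have hπ : biproduct.π Y g ≫ biproduct.ι Y g = 𝟙 _ := by
    refine biproduct.hom_ext' _ _ fun h => ?_
    by_cases hh : h = g
    · subst hh; simp
    · rw [hι h hh]; simp
  exact 𝒢.of_iso g (Y g) X (Iso.mk (biproduct.ι Y g) (biproduct.π Y g) (by simp) hπ ≪≫ e.symm)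
    (hY g)

variable {𝒢}

theorem component_of_retract {g : G} {X Y : C} (r : Retract Y X) (hX : 𝒢.component g X) :
    𝒢.component g Y := by
  rw [component_iff_hom_eq_zero] at hX ⊢
  intro h hh Z hZ f
  rw [← Category.comp_id f, ← r.retract, ← Category.assoc, hX h hh Z hZ (f ≫ r.i), zero_comp]

theorem component_biproduct {J : Type*} [Finite J] {g : G} {S : J → C}
    (hS : ∀ j, 𝒢.component g (S j)) : 𝒢.component g (⨁ S) := by
  rw [component_iff_hom_eq_zero]
  intro h hh Z hZ f
  refine biproduct.hom_ext _ _ fun j => ?_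
  exact (𝒢.hom_eq_zero h g hh Z _ hZ (hS j) _).trans zero_comp.symm

theorem component_biprod {g : G} {X Y : C} (hX : 𝒢.component g X) (hY : 𝒢.component g Y) :
    𝒢.component g (X ⊞ Y) := by
  rw [component_iff_hom_eq_zero]
  intro h hh Z hZ f
  refine biprod.hom_ext _ _ ?_ ?_
  · exact (𝒢.hom_eq_zero h g hh Z X hZ hX _).trans zero_comp.symm
  · exact (𝒢.hom_eq_zero h g hh Z Y hZ hY _).trans zero_comp.symm

theorem component_leftDual {g : G} {X : C} (hX : 𝒢.component g X) :
    𝒢.component g⁻¹ (ᘁX : C) := by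
  rw [𝒢.dual, inv_inv]
  exact 𝒢.of_iso g _ _ (rightDualIso (X := ᘁX) inferInstance inferInstance) hX

theorem component_one_tensor_rightDual {g : G} {X Y : C} (hX : 𝒢.component g X)
    (hY : 𝒢.component g Y) : 𝒢.component 1 (X ⊗ Yᘁ) := by
  simpa using 𝒢.tensor g g⁻¹ X (Yᘁ) hX ((𝒢.dual g Y).1 hY)

theorem component_unique {g h : G} {X : C} (hX : ¬ IsZero X) (hg : 𝒢.component g X)
    (hh : 𝒢.component h X) : g = h := by
  by_contra hne
  exact hX ((IsZero.iff_id_eq_zero X).2 (𝒢.hom_eq_zero g h hne X X hg hh _))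

variable (𝒢) in
theorem exists_component (X : C) [Simple X] : ∃ g, 𝒢.component g X := by
  obtain ⟨Y, hY, ⟨e⟩⟩ := 𝒢.decomposition X
  obtain ⟨g, hg⟩ : ∃ g, biproduct.ι Y g ≫ e.inv ≠ 0 := by
    by_contra! h
    have hinv : e.inv = 0 := biproduct.hom_ext' _ _ fun g => by rw [h g, comp_zero]
    exact id_nonzero X (by rw [← e.hom_inv_id, hinv, comp_zero])
  have := isIso_of_mono_of_nonzero hg
  exact ⟨g, 𝒢.of_iso g _ _ (asIso (biproduct.ι Y g ≫ e.inv)) (hY g)⟩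

theorem component_of_hom_ne_zero {g : G} {S X : C} [Simple S] {f : S ⟶ X} (hf : f ≠ 0)
    (hX : 𝒢.component g X) : 𝒢.component g S := by
  obtain ⟨h, hS⟩ := 𝒢.exists_component S
  obtain rfl : h = g := by
    by_contra hne
    exact hf (𝒢.hom_eq_zero h g hne _ _ hS hX f)
  exact hS

variable (𝒢)

theorem isFusionSubcategory_component_one [Simple (𝟙_ C)] :
    IsFusionSubcategory (𝒢.component 1) where
  unit := 𝒢.unit_mem inferInstance
  tensor X Y hX hY := by simpa using 𝒢.tensor 1 1 X Y hX hY
  rightDual X hX := by simpa using (𝒢.dual 1 X).1 hX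
  leftDual X hX := by simpa using component_leftDual hX
  biprod X Y hX hY := component_biprod hX hY
  summand X Y hX h := component_of_retract h.some hX

theorem adjointSubcategory_le_component_one [Simple (𝟙_ C)] :
    adjointSubcategory C ≤ 𝒢.component 1 := by
  refine fun Y hY => hY _ 𝒢.isFusionSubcategory_component_one fun X hX => ?_
  obtain ⟨g, hg⟩ := 𝒢.exists_component X
  exact component_one_tensor_rightDual hg hg

/-- The degree of a simple object, that is, the index of the component which contains it. -/
noncomputable def degree (X : C) [Simple X] : G := (𝒢.exists_component X).choose

theorem component_degree (X : C) [Simple X] : 𝒢.component (𝒢.degree X) X :=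
  (𝒢.exists_component X).choose_spec

variable {𝒢}

theorem degree_eq_iff {X : C} [Simple X] {g : G} : 𝒢.degree X = g ↔ 𝒢.component g X :=
  ⟨fun h => h ▸ 𝒢.component_degree X,
    component_unique (Simple.not_isZero X) (𝒢.component_degree X)⟩

theorem degree_eq_mul_of_hom_ne_zero {X Y Z : C} [Simple X] [Simple Y] [Simple Z]
    {f : Z ⟶ X ⊗ Y} (hf : f ≠ 0) : 𝒢.degree Z = 𝒢.degree X * 𝒢.degree Y :=
  degree_eq_iff.2 (component_of_hom_ne_zero hf
    (𝒢.tensor _ _ _ _ (𝒢.component_degree X) (𝒢.component_degree Y)))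

section Semisimple

variable (k : Type u) [Field k] [Linear k C] [MonoidalPreadditive C] [MonoidalLinear k C]
  [IsFusionCategory k C]

include k

variable (𝒢) in
theorem component_iff_forall_degree_eq (g : G) (X : C) : 𝒢.component g X ↔
    ∀ z : Irr C, (∃ f : z.rep ⟶ X, f ≠ 0) → 𝒢.degree z.rep = g := by
  refine ⟨fun hX z ⟨f, hf⟩ => degree_eq_iff.2 (component_of_hom_ne_zero hf hX), fun h => ?_⟩
  obtain ⟨n, S, hS, ⟨e⟩⟩ := IsFusionCategory.semisimple k X
  refine 𝒢.of_iso g _ _ e.symm (component_biproduct fun i => ?_)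
  obtain ⟨e'⟩ := Irr.nonempty_rep_mk_iso (S i)
  refine 𝒢.of_iso g _ _ e' (degree_eq_iff.1 (h _ ⟨e'.hom ≫ biproduct.ι S i ≫ e.inv, fun h0 => ?_⟩))
  rw [Preadditive.IsIso.comp_left_eq_zero, Preadditive.IsIso.comp_right_eq_zero] at h0
  exact id_nonzero (S i) (by rw [← biproduct.ι_π_self, h0, zero_comp])

theorem IsFaithful.exists_degree_eq (h𝒢 : 𝒢.IsFaithful) (g : G) :
    ∃ x : Irr C, 𝒢.degree x.rep = g := by
  obtain ⟨X, hX, hX0⟩ := h𝒢 g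
  obtain ⟨x, f, hf⟩ := exists_rep_hom_ne_zero k hX0
  exact ⟨x, degree_eq_iff.2 (component_of_hom_ne_zero hf hX)⟩

theorem exists_component_one_tensor_hom_ne_zero {g : G} {X Y : C} (hX : 𝒢.component g X)
    (hY : 𝒢.component g Y) (hX0 : ¬ IsZero X) (hY0 : ¬ IsZero Y) :
    ∃ S : C, Simple S ∧ 𝒢.component 1 S ∧ ∃ f : S ⊗ X ⟶ Y, f ≠ 0 := by
  have : Simple (𝟙_ C) := IsFusionCategory.simple_unit k
  have hXd : ¬ IsZero (Xᘁ) := fun h =>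
    coevaluation_ne_zero (Y := Xᘁ) hX0 (((tensorLeft X).map_isZero h).eq_of_tgt _ _)
  obtain ⟨z, f, hf⟩ := exists_rep_hom_ne_zero k (not_isZero_tensor hY0 hXd)
  refine ⟨z.rep, inferInstance, component_of_hom_ne_zero hf (component_one_tensor_rightDual hY hX),
    (tensorRightHomEquiv z.rep X (Xᘁ) Y).symm f, fun h => hf ?_⟩
  rw [Equiv.symm_apply_eq] at h
  simpa [tensorRightHomEquiv] using h

end Semisimple

end FusionGrading

/-! ### The universal grading -/

section UniversalDegree

variable {C : Type v} [Category.{w} C] [Abelian C] [MonoidalCategory C]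

/-- The degree of a simple object in the universal grading. -/
def universalDegree (X : C) [Simple X] : UniversalGradingGroup C := PresentedGroup.of (Irr.mk X)

theorem universalDegree_rep (x : Irr C) : universalDegree x.rep = PresentedGroup.of x := by
  rw [universalDegree, Irr.mk_rep]

theorem universalDegree_mul_of_hom_ne_zero {X Y Z : C} [Simple X] [Simple Y] [Simple Z]
    {f : Z ⟶ X ⊗ Y} (hf : f ≠ 0) : universalDegree X * universalDegree Y = universalDegree Z := by
  obtain ⟨eX⟩ := Irr.nonempty_rep_mk_iso X
  obtain ⟨eY⟩ := Irr.nonempty_rep_mk_iso Y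
  obtain ⟨eZ⟩ := Irr.nonempty_rep_mk_iso Z
  refine PresentedGroup.mk_eq_mk_of_mul_inv_mem
    ⟨_, _, _, ⟨eZ.hom ≫ f ≫ (eX.symm ⊗ᵢ eY.symm).hom, fun h => hf ?_⟩, rfl⟩
  rwa [Preadditive.IsIso.comp_left_eq_zero, Preadditive.IsIso.comp_right_eq_zero] at h

theorem universalDegree_mul_of_iso {X Y Z : C} [Simple X] [Simple Y] [Simple Z] (e : X ⊗ Y ≅ Z) :
    universalDegree X * universalDegree Y = universalDegree Z :=
  universalDegree_mul_of_hom_ne_zero (f := e.inv) fun h =>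
    id_nonzero Z (by rw [← e.inv_hom_id, h, zero_comp])

theorem universalDegree_unit [Simple (𝟙_ C)] : universalDegree (𝟙_ C) = 1 :=
  mul_eq_left.1 (universalDegree_mul_of_iso (λ_ (𝟙_ C)))

variable (k : Type u) [Field k] [Linear k C] [MonoidalPreadditive C] [MonoidalLinear k C]
  [RigidCategory C] [IsFusionCategory k C]

include k

theorem exists_universalDegree_eq_mul (X Y : C) [Simple X] [Simple Y] :
    ∃ z : Irr C, universalDegree z.rep = universalDegree X * universalDegree Y := by
  have : Simple (𝟙_ C) := IsFusionCategory.simple_unit k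
  obtain ⟨z, f, hf⟩ := exists_rep_hom_ne_zero k
    (not_isZero_tensor (Simple.not_isZero X) (Simple.not_isZero Y))
  exact ⟨z, (universalDegree_mul_of_hom_ne_zero hf).symm⟩

theorem exists_universalDegree_eq_inv (X : C) [Simple X] :
    ∃ z : Irr C, universalDegree z.rep = (universalDegree X)⁻¹ := by
  have : Simple (𝟙_ C) := IsFusionCategory.simple_unit k
  obtain ⟨n, S, hS, ⟨e⟩⟩ := IsFusionCategory.semisimple k (Xᘁ)
  obtain ⟨i, hi⟩ : ∃ i, η_ X (Xᘁ) ≫ X ◁ (e.hom ≫ biproduct.π S i) ≠ 0 := by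
    by_contra! h
    refine coevaluation_ne_zero (Y := Xᘁ) (Simple.not_isZero X) ?_
    have hid : ∑ i, (e.hom ≫ biproduct.π S i) ≫ biproduct.ι S i ≫ e.inv = 𝟙 (Xᘁ) := by
      have total : ∑ i, biproduct.π S i ≫ biproduct.ι S i ≫ e.inv = e.inv := by
        simp only [← Category.assoc, ← Preadditive.sum_comp, biproduct.total, Category.id_comp]
      simp only [Category.assoc, ← Preadditive.comp_sum, total, e.hom_inv_id]
    rw [← Category.comp_id (η_ X (Xᘁ)), ← MonoidalCategory.whiskerLeft_id, ← hid, whiskerLeft_sum,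
      Preadditive.comp_sum]
    refine Finset.sum_eq_zero fun i _ => ?_
    rw [MonoidalCategory.whiskerLeft_comp, ← Category.assoc, h i, zero_comp]
  refine ⟨Irr.mk (S i), eq_inv_of_mul_eq_one_right ?_⟩
  rw [universalDegree_rep]
  exact (universalDegree_mul_of_hom_ne_zero hi).trans universalDegree_unit

theorem exists_universalDegree_eq (u : UniversalGradingGroup C) :
    ∃ x : Irr C, universalDegree x.rep = u := by
  have : Simple (𝟙_ C) := IsFusionCategory.simple_unit k
  let degrees : Subgroup (UniversalGradingGroup C) :=
    { carrier := Set.range fun x : Irr C => universalDegree x.rep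
      mul_mem' := by
        rintro _ _ ⟨x, rfl⟩ ⟨y, rfl⟩
        exact exists_universalDegree_eq_mul k x.rep y.rep
      one_mem' := ⟨Irr.mk (𝟙_ C), (universalDegree_rep _).trans universalDegree_unit⟩
      inv_mem' := by
        rintro _ ⟨x, rfl⟩
        exact exists_universalDegree_eq_inv k x.rep }
  exact PresentedGroup.generated_by _ degrees (fun x => ⟨x, universalDegree_rep x⟩) u

end UniversalDegree

namespace FusionGrading

variable {G : Type t} [Group G] [Finite G] {C : Type v} [Category.{w} C] [Abelian C]
  [MonoidalCategory C] [RigidCategory C] (𝒢 : FusionGrading G C)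

/-- The homomorphism from the universal grading group which induces the given grading. -/
noncomputable def universalHom : UniversalGradingGroup C →* G :=
  PresentedGroup.toGroup (f := fun x => 𝒢.degree x.rep) <| by
    rintro _ ⟨x, y, z, ⟨f, hf⟩, rfl⟩
    simp [degree_eq_mul_of_hom_ne_zero hf]

theorem universalHom_of (x : Irr C) : 𝒢.universalHom (PresentedGroup.of x) = 𝒢.degree x.rep :=
  PresentedGroup.toGroup.of _

variable {𝒢} (k : Type u) [Field k] [Linear k C] [MonoidalPreadditive C] [MonoidalLinear k C]
  [IsFusionCategory k C]

include k

theorem IsFaithful.universalHom_surjective (h𝒢 : 𝒢.IsFaithful) :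
    Function.Surjective 𝒢.universalHom := fun g => by
  obtain ⟨x, hx⟩ := h𝒢.exists_degree_eq k g
  exact ⟨PresentedGroup.of x, by rw [universalHom_of, hx]⟩

theorem universalHom_injective
    (h : ∀ z : Irr C, 𝒢.component 1 z.rep → universalDegree z.rep = 1) :
    Function.Injective 𝒢.universalHom := by
  rw [injective_iff_map_eq_one]
  intro u hu
  obtain ⟨x, rfl⟩ := exists_universalDegree_eq k u
  rw [universalDegree_rep, universalHom_of, degree_eq_iff] at hu
  exact h x hu

theorem universalComponent_eq (h : Function.Injective 𝒢.universalHom)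
    (u : UniversalGradingGroup C) :
    universalComponent C u = 𝒢.component (𝒢.universalHom u) := by
  ext X
  rw [𝒢.component_iff_forall_degree_eq k, universalComponent]
  simp only [← universalHom_of, h.eq_iff]

end FusionGrading

/-! ### Gradings whose trivial component has two simple objects -/

namespace FusionGrading

variable {G : Type t} [Group G] [Finite G] {C : Type v} [Category.{w} C] [Abelian C]
  [MonoidalCategory C] [RigidCategory C]

/-- The simple objects of the trivial component of a grading are `𝟙` and `δ`, where `δ` is a
nontrivial object of order two. -/
structure IsGeneratedByInvolution (𝒢 : FusionGrading G C) (δ : C) : Prop where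
  mem : 𝒢.component 1 δ
  mul_self : toSkeleton δ * toSkeleton δ = 1
  ne_one : toSkeleton δ ≠ 1
  eq_or_eq : ∀ S : C, Simple S → 𝒢.component 1 S →
    toSkeleton S = 1 ∨ toSkeleton S = toSkeleton δ

namespace IsGeneratedByInvolution

attribute [local instance] IsFusionCategory.finiteDimensional_hom

variable {𝒢 : FusionGrading G C} {δ : C}

theorem isUnit (hδ : 𝒢.IsGeneratedByInvolution δ) : IsUnit (toSkeleton δ) :=
  ⟨⟨_, _, hδ.mul_self, hδ.mul_self⟩, rfl⟩

theorem isUnit_of_component_one (hδ : 𝒢.IsGeneratedByInvolution δ) {S : C} [Simple S]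
    (hS : 𝒢.component 1 S) : IsUnit (toSkeleton S) := by
  rcases hδ.eq_or_eq S inferInstance hS with h | h <;> rw [h]
  exacts [isUnit_one, hδ.isUnit]

variable (k : Type u) [Field k] [Linear k C] [MonoidalPreadditive C] [MonoidalLinear k C]
  [IsFusionCategory k C]

include k

theorem eq_or_eq_mul_left (hδ : 𝒢.IsGeneratedByInvolution δ) {g : G} {X Y : C} [Simple X]
    [Simple Y] (hX : 𝒢.component g X) (hY : 𝒢.component g Y) :
    toSkeleton Y = toSkeleton X ∨ toSkeleton Y = toSkeleton δ * toSkeleton X := by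
  obtain ⟨S, _, hS, f, hf⟩ := exists_component_one_tensor_hom_ne_zero k hX hY
    (Simple.not_isZero X) (Simple.not_isZero Y)
  have := simple_tensor_of_isUnit_left (hδ.isUnit_of_component_one hS) X
  have := isIso_of_hom_simple hf
  have hY_eq : toSkeleton Y = toSkeleton S * toSkeleton X := by
    rw [← Skeleton.toSkeleton_tensorObj, congr_toSkeleton_of_iso (asIso f)]
  rw [hY_eq]
  rcases hδ.eq_or_eq S inferInstance hS with h | h <;> rw [h]
  · exact Or.inl (one_mul _)
  · exact Or.inr rfl

variable [IsAlgClosed k]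

theorem nonempty_iso_of_finrank_hom_eq (hδ : 𝒢.IsGeneratedByInvolution δ) {X Y : C}
    (hX : 𝒢.component 1 X) (hY : 𝒢.component 1 Y)
    (hone : Module.finrank k (𝟙_ C ⟶ X) = Module.finrank k (𝟙_ C ⟶ Y))
    (hinvol : Module.finrank k (δ ⟶ X) = Module.finrank k (δ ⟶ Y)) : Nonempty (X ≅ Y) := by
  refine _root_.nonempty_iso_of_finrank_hom_eq k fun z => ?_
  by_cases hz : 𝒢.component 1 z.rep
  · rcases hδ.eq_or_eq z.rep inferInstance hz with h | h
    · rw [Skeleton.one_eq, toSkeleton_eq_toSkeleton_iff] at h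
      rwa [finrank_hom_congr k h.some (Iso.refl X), finrank_hom_congr k h.some (Iso.refl Y)]
    · rw [toSkeleton_eq_toSkeleton_iff] at h
      rwa [finrank_hom_congr k h.some (Iso.refl X), finrank_hom_congr k h.some (Iso.refl Y)]
  · have hom_eq_zero {Z : C} (hZ : 𝒢.component 1 Z) : Module.finrank k (z.rep ⟶ Z) = 0 := by
      have : Subsingleton (z.rep ⟶ Z) := subsingleton_of_forall_eq 0 fun f => by
        by_contra hf
        exact hz (component_of_hom_ne_zero hf hZ)
      exact Module.finrank_zero_of_subsingleton
    rw [hom_eq_zero hX, hom_eq_zero hY]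

theorem isUnit_iff (hδ : 𝒢.IsGeneratedByInvolution δ) (X : C) [Simple X] :
    IsUnit (toSkeleton X) ↔ toSkeleton δ * toSkeleton X ≠ toSkeleton X := by
  classical
  have : Simple (𝟙_ C) := IsFusionCategory.simple_unit k
  have := simple_of_isUnit hδ.isUnit
  refine ⟨fun hX h => hδ.ne_one (hX.mul_eq_right.1 h), fun h => ?_⟩
  rw [← isInvertibleObj_iff_isUnit]
  refine hδ.nonempty_iso_of_finrank_hom_eq k
    (component_one_tensor_rightDual (𝒢.component_degree X) (𝒢.component_degree X))
    (𝒢.unit_mem inferInstance) ?_ ?_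
  · rw [finrank_hom_tensor_rightDual k (S := 𝟙_ C) isUnit_one, if_pos,
      finrank_hom_simple, if_pos rfl]
    exact one_mul (toSkeleton X)
  · rw [finrank_hom_tensor_rightDual k hδ.isUnit, if_neg h, finrank_hom_simple,
      ← Skeleton.one_eq, if_neg hδ.ne_one]

theorem mul_left_eq_of_not_isUnit (hδ : 𝒢.IsGeneratedByInvolution δ) {X : C} [Simple X]
    (hX : ¬ IsUnit (toSkeleton X)) : toSkeleton δ * toSkeleton X = toSkeleton X := by
  rwa [hδ.isUnit_iff k, not_not] at hX

theorem eq_of_not_isUnit (hδ : 𝒢.IsGeneratedByInvolution δ) {g : G} {X Y : C} [Simple X]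
    [Simple Y] (hX : 𝒢.component g X) (hY : 𝒢.component g Y) (hXu : ¬ IsUnit (toSkeleton X)) :
    toSkeleton Y = toSkeleton X := by
  simpa only [hδ.mul_left_eq_of_not_isUnit k hXu, or_self] using hδ.eq_or_eq_mul_left k hX hY

theorem mul_right_eq_of_not_isUnit (hδ : 𝒢.IsGeneratedByInvolution δ) {X : C} [Simple X]
    (hX : ¬ IsUnit (toSkeleton X)) : toSkeleton X * toSkeleton δ = toSkeleton X := by
  have := simple_tensor_of_isUnit_right hδ.isUnit X
  have hXδ : 𝒢.component (𝒢.degree X) (X ⊗ δ) := by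
    simpa using 𝒢.tensor _ _ _ _ (𝒢.component_degree X) hδ.mem
  rw [← Skeleton.toSkeleton_tensorObj]
  exact hδ.eq_of_not_isUnit k (𝒢.component_degree X) hXδ hX

theorem nonempty_tensor_rightDual_iso (hδ : 𝒢.IsGeneratedByInvolution δ) {X : C} [Simple X]
    (hX : ¬ IsUnit (toSkeleton X)) : Nonempty (X ⊗ Xᘁ ≅ ⨁ ![𝟙_ C, δ]) := by
  classical
  have : Simple (𝟙_ C) := IsFusionCategory.simple_unit k
  have := simple_of_isUnit hδ.isUnit
  have finrank_hom_pair (Z : C) : Module.finrank k (Z ⟶ ⨁ ![𝟙_ C, δ]) =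
      Module.finrank k (Z ⟶ 𝟙_ C) + Module.finrank k (Z ⟶ δ) := by
    rw [finrank_hom_biproduct, Fin.sum_univ_two]
    rfl
  refine hδ.nonempty_iso_of_finrank_hom_eq k
    (component_one_tensor_rightDual (𝒢.component_degree X) (𝒢.component_degree X))
    (component_biproduct fun i => ?_) ?_ ?_
  · fin_cases i
    exacts [𝒢.unit_mem inferInstance, hδ.mem]
  · rw [finrank_hom_tensor_rightDual k (S := 𝟙_ C) isUnit_one, if_pos, finrank_hom_pair,
      finrank_hom_simple, finrank_hom_simple, if_pos rfl, ← Skeleton.one_eq, if_neg hδ.ne_one.symm]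
    exact one_mul (toSkeleton X)
  · rw [finrank_hom_tensor_rightDual k hδ.isUnit, if_pos (hδ.mul_left_eq_of_not_isUnit k hX),
      finrank_hom_pair, finrank_hom_simple, finrank_hom_simple, if_pos rfl, ← Skeleton.one_eq,
      if_neg hδ.ne_one]

theorem finrank_end_tensor (hδ : 𝒢.IsGeneratedByInvolution δ) {X Y : C} [Simple X] [Simple Y]
    (hX : ¬ IsUnit (toSkeleton X)) (hY : ¬ IsUnit (toSkeleton Y)) :
    Module.finrank k (X ⊗ Y ⟶ X ⊗ Y) = 2 := by
  obtain ⟨e⟩ := hδ.nonempty_tensor_rightDual_iso k hY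
  have finrank_eq_one {Z : C} (h : toSkeleton (X ⊗ Z) = toSkeleton X) :
      Module.finrank k (X ⟶ X ⊗ Z) = 1 := by
    have := Simple.of_iso (toSkeleton_eq_toSkeleton_iff.1 h).some
    rw [finrank_hom_simple, if_pos h.symm]
  have hone := finrank_eq_one (congr_toSkeleton_of_iso (ρ_ X))
  have hinvol := finrank_eq_one
    ((Skeleton.toSkeleton_tensorObj X δ).trans (hδ.mul_right_eq_of_not_isUnit k hX))
  calc Module.finrank k (X ⊗ Y ⟶ X ⊗ Y)
      = Module.finrank k (X ⟶ (X ⊗ Y) ⊗ Yᘁ) := finrank_tensorRight_hom k X Y (Yᘁ) _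
    _ = Module.finrank k (X ⟶ ⨁ fun i => X ⊗ ![𝟙_ C, δ] i) :=
        finrank_hom_congr k (Iso.refl X)
          (α_ _ _ _ ≪≫ whiskerLeftIso X e ≪≫ leftDistributor X ![𝟙_ C, δ])
    _ = Module.finrank k (X ⟶ X ⊗ 𝟙_ C) + Module.finrank k (X ⟶ X ⊗ δ) := by
        rw [finrank_hom_biproduct, Fin.sum_univ_two]
        rfl
    _ = 2 := by rw [hone, hinvol]

theorem exists_tensor_iso_biproduct (hδ : 𝒢.IsGeneratedByInvolution δ) {X Y : C} [Simple X]
    [Simple Y] (hX : ¬ IsUnit (toSkeleton X)) (hY : ¬ IsUnit (toSkeleton Y)) :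
    ∃ S : Fin 2 → C, (∀ i, IsUnit (toSkeleton (S i))) ∧ Nonempty (X ⊗ Y ≅ ⨁ S) := by
  obtain ⟨S, hS, hne, ⟨e⟩⟩ :=
    exists_iso_biproduct_of_finrank_end_eq_two k (hδ.finrank_end_tensor k hX hY)
  have hS_mem (i : Fin 2) : 𝒢.component (𝒢.degree X * 𝒢.degree Y) (S i) :=
    component_of_retract ⟨biproduct.ι S i ≫ e.inv, e.hom ≫ biproduct.π S i, by simp⟩
      (𝒢.tensor _ _ _ _ (𝒢.component_degree X) (𝒢.component_degree Y))
  refine ⟨S, fun i => ?_, ⟨e⟩⟩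
  by_contra hi
  exact hne ((hδ.eq_of_not_isUnit k (hS_mem i) (hS_mem 0) hi).trans
    (hδ.eq_of_not_isUnit k (hS_mem i) (hS_mem 1) hi).symm)

theorem isGeneralizedTambaraYamagami (hδ : 𝒢.IsGeneratedByInvolution δ) (h : ¬ IsPointed C) :
    IsGeneralizedTambaraYamagami C := by
  have : Simple (𝟙_ C) := IsFusionCategory.simple_unit k
  refine ⟨h, fun X Y _ _ hX hY => ?_⟩
  rw [isInvertibleObj_iff_isUnit] at hX hY
  obtain ⟨S, hS, e⟩ := hδ.exists_tensor_iso_biproduct k hX hY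
  exact ⟨2, S, fun i => isInvertibleObj_iff_isUnit.2 (hS i), e⟩

theorem universalDegree_eq_one (hδ : 𝒢.IsGeneratedByInvolution δ) {X : C} [Simple X]
    (hX : ¬ IsUnit (toSkeleton X)) {S : C} [Simple S] (hS : 𝒢.component 1 S) :
    universalDegree S = 1 := by
  have hSX : toSkeleton (S ⊗ X) = toSkeleton X := by
    rw [Skeleton.toSkeleton_tensorObj]
    rcases hδ.eq_or_eq S inferInstance hS with h | h <;> rw [h]
    · exact one_mul _
    · exact hδ.mul_left_eq_of_not_isUnit k hX
  obtain ⟨e⟩ := toSkeleton_eq_toSkeleton_iff.1 hSX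
  exact mul_eq_right.1 (universalDegree_mul_of_iso e)

theorem component_one_eq_adjointSubcategory (hδ : 𝒢.IsGeneratedByInvolution δ) {X : C}
    [Simple X] (hX : ¬ IsUnit (toSkeleton X)) : 𝒢.component 1 = adjointSubcategory C := by
  have : Simple (𝟙_ C) := IsFusionCategory.simple_unit k
  refine le_antisymm (fun Y hY P hP hPX => ?_) 𝒢.adjointSubcategory_le_component_one
  have hPδ : P δ := by
    obtain ⟨e⟩ := hδ.nonempty_tensor_rightDual_iso k hX
    exact hP.summand _ _ (hP.of_iso e (hPX X inferInstance))
      ⟨⟨biproduct.ι ![𝟙_ C, δ] 1, biproduct.π ![𝟙_ C, δ] 1, biproduct.ι_π_self _ _⟩⟩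
  obtain ⟨n, S, hS, ⟨e⟩⟩ := IsFusionCategory.semisimple k Y
  refine hP.of_iso e.symm (hP.biproduct fun i => ?_)
  have hS_mem : 𝒢.component 1 (S i) :=
    component_of_retract ⟨biproduct.ι S i ≫ e.inv, e.hom ≫ biproduct.π S i, by simp⟩ hY
  rcases hδ.eq_or_eq (S i) inferInstance hS_mem with h | h
  · rw [Skeleton.one_eq, toSkeleton_eq_toSkeleton_iff] at h
    exact hP.of_iso h.some.symm hP.unit
  · rw [toSkeleton_eq_toSkeleton_iff] at h
    exact hP.of_iso h.some.symm hPδ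

end IsGeneratedByInvolution

end FusionGrading

section SimpleDimension

variable {C : Type v} [Category.{w} C] [MonoidalCategory C]

open Classical in
/-- The expected dimension of a simple object: `1` if it is invertible and `√2` if not. -/
noncomputable def simpleDim (X : C) : ℝ := if IsUnit (toSkeleton X) then 1 else √2

theorem simpleDim_of_isUnit {X : C} (hX : IsUnit (toSkeleton X)) : simpleDim X = 1 := if_pos hX

theorem simpleDim_of_not_isUnit {X : C} (hX : ¬ IsUnit (toSkeleton X)) : simpleDim X = √2 :=
  if_neg hX

theorem simpleDim_pos (X : C) : 0 < simpleDim X := by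
  unfold simpleDim
  split_ifs <;> positivity

theorem simpleDim_congr {X Y : C} (h : IsUnit (toSkeleton X) ↔ IsUnit (toSkeleton Y)) :
    simpleDim X = simpleDim Y := by
  classical
  exact if_congr h rfl rfl

theorem simpleDim_tensor_of_isUnit_left {X : C} (hX : IsUnit (toSkeleton X)) (Y : C) :
    simpleDim (X ⊗ Y) = simpleDim Y := by
  obtain ⟨u, hu⟩ := hX
  exact simpleDim_congr (by rw [Skeleton.toSkeleton_tensorObj, ← hu, Units.isUnit_units_mul])

theorem simpleDim_tensor_of_isUnit_right {Y : C} (hY : IsUnit (toSkeleton Y)) (X : C) :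
    simpleDim (X ⊗ Y) = simpleDim X := by
  obtain ⟨u, hu⟩ := hY
  exact simpleDim_congr (by rw [Skeleton.toSkeleton_tensorObj, ← hu, Units.isUnit_mul_units])

end SimpleDimension

theorem sum_simpleDim_mul_finrank (k : Type u) [Field k] [IsAlgClosed k] {C : Type v}
    [Category.{w} C] [Abelian C] [Linear k C] [∀ X Y : C, FiniteDimensional k (X ⟶ Y)]
    [MonoidalCategory C] [Fintype (Irr C)] (S : C) [Simple S] :
    ∑ z : Irr C, simpleDim z.rep * (Module.finrank k (z.rep ⟶ S) : ℝ) = simpleDim S := by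
  classical
  rw [Finset.sum_eq_single_of_mem (Irr.mk S) (Finset.mem_univ _)]
  · rw [finrank_hom_simple, if_pos (Irr.toSkeleton_rep_mk S), Nat.cast_one, mul_one,
      simpleDim_congr (iff_of_eq (congrArg IsUnit (Irr.toSkeleton_rep_mk S)))]
  · intro z _ hz
    rw [finrank_hom_simple, if_neg, Nat.cast_zero, mul_zero]
    rwa [← Irr.mk_eq_mk_iff, Irr.mk_rep]

namespace FusionGrading.IsGeneratedByInvolution

attribute [local instance] IsFusionCategory.finiteDimensional_hom

variable {G : Type t} [Group G] [Finite G] {C : Type v} [Category.{w} C] [Abelian C]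
  [MonoidalCategory C] [RigidCategory C] {𝒢 : FusionGrading G C} {δ : C} (k : Type u) [Field k]
  [IsAlgClosed k] [Linear k C] [MonoidalPreadditive C] [MonoidalLinear k C] [IsFusionCategory k C]

theorem sum_simpleDim_mul_finrank_tensor (hδ : 𝒢.IsGeneratedByInvolution δ) [Fintype (Irr C)]
    (X Y : C) [Simple X] [Simple Y] :
    ∑ z : Irr C, simpleDim z.rep * (Module.finrank k (z.rep ⟶ X ⊗ Y) : ℝ) =
      simpleDim X * simpleDim Y := by
  have : Simple (𝟙_ C) := IsFusionCategory.simple_unit k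
  by_cases hX : IsUnit (toSkeleton X)
  · have := simple_tensor_of_isUnit_left hX Y
    rw [sum_simpleDim_mul_finrank, simpleDim_tensor_of_isUnit_left hX, simpleDim_of_isUnit hX,
      one_mul]
  by_cases hY : IsUnit (toSkeleton Y)
  · have := simple_tensor_of_isUnit_right hY X
    rw [sum_simpleDim_mul_finrank, simpleDim_tensor_of_isUnit_right hY, simpleDim_of_isUnit hY,
      mul_one]
  obtain ⟨S, hS, ⟨e⟩⟩ := hδ.exists_tensor_iso_biproduct k hX hY
  have (i : Fin 2) : Simple (S i) := simple_of_isUnit (hS i)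
  simp only [finrank_hom_congr k (Iso.refl _) e, finrank_hom_biproduct, Fin.sum_univ_two,
    Nat.cast_add, mul_add, Finset.sum_add_distrib, sum_simpleDim_mul_finrank]
  rw [simpleDim_of_isUnit (hS 0), simpleDim_of_isUnit (hS 1), simpleDim_of_not_isUnit hX,
    simpleDim_of_not_isUnit hY, Real.mul_self_sqrt zero_le_two, one_add_one_eq_two]

include k

theorem FPdim_eq_simpleDim (hδ : 𝒢.IsGeneratedByInvolution δ) (X : C) [Simple X] :
    FPdim k X = simpleDim X := by
  have : Finite (Irr C) := IsFusionCategory.finite_irr k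
  have := Fintype.ofFinite (Irr C)
  have : Nonempty (Irr C) := ⟨Irr.mk X⟩
  exact FPdim_eq_of_pos k (fun z => simpleDim_pos z.rep)
    fun y => hδ.sum_simpleDim_mul_finrank_tensor k X y.rep

theorem FPdim_eq_one_iff (hδ : 𝒢.IsGeneratedByInvolution δ) (X : C) [Simple X] :
    FPdim k X = 1 ↔ IsUnit (toSkeleton X) := by
  rw [hδ.FPdim_eq_simpleDim k]
  refine ⟨fun h => ?_, simpleDim_of_isUnit⟩
  by_contra hX
  exact Real.one_lt_sqrt_two.ne' ((simpleDim_of_not_isUnit hX).symm.trans h)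

theorem FPdim_eq_sqrt_two_iff (hδ : 𝒢.IsGeneratedByInvolution δ) (X : C) [Simple X] :
    FPdim k X = √2 ↔ ¬ IsUnit (toSkeleton X) := by
  rw [hδ.FPdim_eq_simpleDim k]
  exact ⟨fun h hX => Real.one_lt_sqrt_two.ne ((simpleDim_of_isUnit hX).symm.trans h),
    simpleDim_of_not_isUnit⟩

theorem isOfType (hδ : 𝒢.IsGeneratedByInvolution δ) {m n : ℕ} (hm : 0 < m) (hn : 0 < n)
    (hm_card : Nat.card {x : Irr C // IsUnit (toSkeleton x.rep)} = m)
    (hn_card : Nat.card {x : Irr C // ¬ IsUnit (toSkeleton x.rep)} = n) :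
    IsOfType k C ![1, √2] ![m, n] := by
  have card_one : Nat.card {x : Irr C // FPdim k x.rep = 1} = m := by
    simpa only [hδ.FPdim_eq_one_iff k] using hm_card
  have card_sqrt_two : Nat.card {x : Irr C // FPdim k x.rep = √2} = n := by
    simpa only [hδ.FPdim_eq_sqrt_two_iff k] using hn_card
  refine ⟨rfl, ?_, Fin.forall_fin_two.2 ⟨hm, hn⟩, fun i => ?_, fun x => ?_⟩
  · simpa [Fin.strictMono_iff_lt_succ] using Real.one_lt_sqrt_two
  · fin_cases i
    exacts [card_one, card_sqrt_two]
  · by_cases hx : IsUnit (toSkeleton x.rep)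
    · exact ⟨0, (hδ.FPdim_eq_one_iff k x.rep).2 hx⟩
    · exact ⟨1, (hδ.FPdim_eq_sqrt_two_iff k x.rep).2 hx⟩

end FusionGrading.IsGeneratedByInvolution

/-! ### Counting simple objects -/

section InvertibleGroup

variable {C : Type v} [Category.{w} C] [HasZeroMorphisms C] [MonoidalCategory C] [Simple (𝟙_ C)]

instance simple_fromSkeleton_obj (u : InvertibleGroup C) :
    Simple ((fromSkeleton C).obj (u : Skeleton C)) :=
  simple_of_isUnit ((toSkeleton_fromSkeleton_obj (u : Skeleton C)).symm ▸ u.isUnit)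

theorem card_isUnit_toSkeleton_rep :
    Nat.card {x : Irr C // IsUnit (toSkeleton x.rep)} = Nat.card (InvertibleGroup C) := by
  refine Nat.card_congr (Equiv.ofBijective (fun x => x.2.unit) ⟨fun x y h => ?_, fun u => ?_⟩)
  · rw [Subtype.ext_iff, ← Irr.mk_rep x.1, ← Irr.mk_rep y.1, Irr.mk_eq_mk_iff]
    exact congrArg Units.val h
  · have hrep : toSkeleton (Irr.mk ((fromSkeleton C).obj (u : Skeleton C))).rep = u :=
      (Irr.toSkeleton_rep_mk _).trans (toSkeleton_fromSkeleton_obj _)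
    exact ⟨⟨Irr.mk _, hrep.symm ▸ u.isUnit⟩, Units.ext hrep⟩

end InvertibleGroup

namespace FusionGrading

variable {G : Type t} [Group G] [Finite G] {C : Type v} [Category.{w} C] [Abelian C]
  [MonoidalCategory C] [RigidCategory C]

theorem degree_congr {𝒢 : FusionGrading G C} {X Y : C} [Simple X] [Simple Y]
    (h : toSkeleton X = toSkeleton Y) : 𝒢.degree X = 𝒢.degree Y :=
  degree_eq_iff.2 (𝒢.of_iso _ _ _ (toSkeleton_eq_toSkeleton_iff.1 h).some.symm
    (𝒢.component_degree Y))

section DegreeHom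

variable [Simple (𝟙_ C)] (𝒢 : FusionGrading G C)

/-- The degree of invertible objects, as a homomorphism on the group of their classes. -/
noncomputable def degreeHom : InvertibleGroup C →* G :=
  MonoidHom.mk' (fun u => 𝒢.degree ((fromSkeleton C).obj (u : Skeleton C))) fun u v => by
    refine degree_eq_iff.2 (𝒢.of_iso _ _ _ (toSkeleton_eq_toSkeleton_iff.1 ?_).some
      (𝒢.tensor _ _ _ _ (𝒢.component_degree _) (𝒢.component_degree _)))
    simp only [Skeleton.toSkeleton_tensorObj, toSkeleton_fromSkeleton_obj, Units.val_mul]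

theorem degreeHom_unit {X : C} [Simple X] (hX : IsUnit (toSkeleton X)) :
    𝒢.degreeHom hX.unit = 𝒢.degree X :=
  degree_congr (toSkeleton_fromSkeleton_obj _)

theorem mem_range_degreeHom_iff {g : G} :
    g ∈ 𝒢.degreeHom.range ↔ ∃ X : C, IsUnit (toSkeleton X) ∧ 𝒢.component g X := by
  constructor
  · rintro ⟨u, rfl⟩
    exact ⟨_, (toSkeleton_fromSkeleton_obj (u : Skeleton C)).symm ▸ u.isUnit,
      𝒢.component_degree _⟩
  · rintro ⟨X, hX, hg⟩
    have := simple_of_isUnit hX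
    exact ⟨hX.unit, (𝒢.degreeHom_unit hX).trans (degree_eq_iff.2 hg)⟩

end DegreeHom

namespace IsGeneratedByInvolution

variable {𝒢 : FusionGrading G C} {δ : C} [Simple (𝟙_ C)]

theorem ker_degreeHom (hδ : 𝒢.IsGeneratedByInvolution δ) :
    𝒢.degreeHom.ker = Subgroup.zpowers hδ.isUnit.unit := by
  have := simple_of_isUnit hδ.isUnit
  refine le_antisymm (fun u hu => ?_) ?_
  · rcases hδ.eq_or_eq _ inferInstance (degree_eq_iff.1 hu) with h | h <;>
      rw [toSkeleton_fromSkeleton_obj] at h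
    · exact (Units.ext h : u = 1) ▸ one_mem _
    · exact (Units.ext h : u = hδ.isUnit.unit) ▸ Subgroup.mem_zpowers _
  · rw [Subgroup.zpowers_le, MonoidHom.mem_ker, degreeHom_unit]
    exact degree_eq_iff.2 hδ.mem

theorem card_invertibleGroup (hδ : 𝒢.IsGeneratedByInvolution δ) :
    Nat.card (InvertibleGroup C) = 2 * Nat.card 𝒢.degreeHom.range := by
  have orderOf_eq_two : orderOf hδ.isUnit.unit = 2 :=
    orderOf_eq_prime (Units.ext ((sq _).trans hδ.mul_self)) fun h =>
      hδ.ne_one (congrArg Units.val h)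
  rw [← Subgroup.card_mul_index 𝒢.degreeHom.ker, Subgroup.index_ker, hδ.ker_degreeHom,
    Nat.card_zpowers, orderOf_eq_two]

variable (k : Type u) [Field k] [IsAlgClosed k] [Linear k C] [MonoidalPreadditive C]
  [MonoidalLinear k C] [IsFusionCategory k C]

include k

theorem degree_mem_range_degreeHom_iff (hδ : 𝒢.IsGeneratedByInvolution δ) (X : C) [Simple X] :
    𝒢.degree X ∈ 𝒢.degreeHom.range ↔ IsUnit (toSkeleton X) := by
  rw [mem_range_degreeHom_iff]
  refine ⟨fun ⟨Y, hY, hYX⟩ => ?_, fun hX => ⟨X, hX, 𝒢.component_degree X⟩⟩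
  by_contra hX
  have := simple_of_isUnit hY
  exact hX (hδ.eq_of_not_isUnit k (𝒢.component_degree X) hYX hX ▸ hY)

theorem index_range_degreeHom (hδ : 𝒢.IsGeneratedByInvolution δ) (h𝒢 : 𝒢.IsFaithful) {X : C}
    [Simple X] (hX : ¬ IsUnit (toSkeleton X)) : 𝒢.degreeHom.range.index = 2 := by
  rw [Subgroup.index_eq_two_iff]
  refine ⟨𝒢.degree X, fun g => ?_⟩
  obtain ⟨y, rfl⟩ := h𝒢.exists_degree_eq k g
  have hyX := 𝒢.tensor _ _ _ _ (𝒢.component_degree y.rep) (𝒢.component_degree X)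
  rw [hδ.degree_mem_range_degreeHom_iff k y.rep]
  by_cases hy : IsUnit (toSkeleton y.rep)
  · have := simple_tensor_of_isUnit_left hy X
    refine Or.inr ⟨hy, ?_⟩
    rw [← degree_eq_iff.2 hyX, hδ.degree_mem_range_degreeHom_iff k]
    obtain ⟨u, hu⟩ := hy
    rwa [Skeleton.toSkeleton_tensorObj, ← hu, Units.isUnit_units_mul]
  · obtain ⟨S, hS, ⟨e⟩⟩ := hδ.exists_tensor_iso_biproduct k hy hX
    exact Or.inl ⟨𝒢.mem_range_degreeHom_iff.2 ⟨S 0, hS 0, component_of_retract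
      ⟨biproduct.ι S 0 ≫ e.inv, e.hom ≫ biproduct.π S 0, by simp⟩ hyX⟩, hy⟩

theorem card_not_isUnit_toSkeleton_rep (hδ : 𝒢.IsGeneratedByInvolution δ) (h𝒢 : 𝒢.IsFaithful) :
    Nat.card {x : Irr C // ¬ IsUnit (toSkeleton x.rep)} =
      Nat.card ((𝒢.degreeHom.range : Set G)ᶜ : Set G) := by
  refine Nat.card_congr (Equiv.ofBijective (fun x => ⟨𝒢.degree x.1.rep, fun h =>
    x.2 ((hδ.degree_mem_range_degreeHom_iff k x.1.rep).1 h)⟩) ⟨fun x y hxy => ?_, ?_⟩)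
  · rw [Subtype.ext_iff, ← Irr.mk_rep x.1, ← Irr.mk_rep y.1, Irr.mk_eq_mk_iff]
    exact hδ.eq_of_not_isUnit k (𝒢.component_degree y.1.rep)
      (degree_eq_iff.1 (congrArg Subtype.val hxy)) y.2
  · rintro ⟨g, hg⟩
    obtain ⟨x, rfl⟩ := h𝒢.exists_degree_eq k g
    exact ⟨⟨x, fun hx => hg ((hδ.degree_mem_range_degreeHom_iff k x.rep).2 hx)⟩, rfl⟩

theorem card_not_isUnit_eq_card_range (hδ : 𝒢.IsGeneratedByInvolution δ) (h𝒢 : 𝒢.IsFaithful)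
    {X : C} [Simple X] (hX : ¬ IsUnit (toSkeleton X)) :
    Nat.card {x : Irr C // ¬ IsUnit (toSkeleton x.rep)} = Nat.card 𝒢.degreeHom.range := by
  have card_mul_two : Nat.card 𝒢.degreeHom.range * 2 = Nat.card G := by
    rw [← hδ.index_range_degreeHom k h𝒢 hX, Subgroup.card_mul_index]
  have card_add_card_compl : Nat.card 𝒢.degreeHom.range +
      Nat.card ((𝒢.degreeHom.range : Set G)ᶜ : Set G) = Nat.card G :=
    Set.ncard_add_ncard_compl (𝒢.degreeHom.range : Set G)
  rw [hδ.card_not_isUnit_toSkeleton_rep k h𝒢]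
  omega

end IsGeneratedByInvolution

end FusionGrading

/-! ### Extensions of Vec_Γ^ω -/

section TwistedVect

variable {Γ : Type t} [Group Γ] [Fintype Γ] {k : Type u} [Field k] {ω : ThreeCocycle Γ k}
  {C : Type v} [Category.{w} C] [Preadditive C] (F : TwistedVect ω ⥤ C)

theorem toSkeleton_obj_line_ne [F.PreservesZeroMorphisms] [F.Full] {a b : Γ}
    [Simple (F.obj (TwistedVect.line ω a))] (hab : a ≠ b) :
    toSkeleton (F.obj (TwistedVect.line ω a)) ≠ toSkeleton (F.obj (TwistedVect.line ω b)) := by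
  intro h
  obtain ⟨e⟩ := toSkeleton_eq_toSkeleton_iff.1 h
  apply id_nonzero (F.obj (TwistedVect.line ω a))
  rw [← e.hom_inv_id, ← F.map_preimage e.hom, TwistedVect.line_hom_eq_zero hab (F.preimage _),
    F.map_zero, zero_comp]

theorem exists_toSkeleton_obj_eq_line [F.PreservesZeroMorphisms] [F.Faithful] [HasKernels C]
    [∀ a, Simple (F.obj (TwistedVect.line ω a))] (V : TwistedVect ω) [Simple (F.obj V)] :
    ∃ a, toSkeleton (F.obj V) = toSkeleton (F.obj (TwistedVect.line ω a)) := by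
  have hV : 𝟙 V ≠ 0 := fun h => id_nonzero (F.obj V) (by rw [← F.map_id, h, F.map_zero])
  obtain ⟨a, f, hf⟩ := TwistedVect.exists_line_hom_ne_zero V hV
  have hFf : F.map f ≠ 0 := fun h => hf (F.map_injective (h.trans (F.map_zero _ _).symm))
  have := isIso_of_hom_simple hFf
  exact ⟨a, (congr_toSkeleton_of_iso (asIso (F.map f))).symm⟩

end TwistedVect

namespace FusionGrading.IsExtensionOf

variable {G : Type t} [Group G] [Finite G] {C : Type v} [Category.{w} C] [Abelian C]
  [MonoidalCategory C] [RigidCategory C] {𝒢 : FusionGrading G C} {k : Type u} [Field k]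
  [Linear k C] [MonoidalPreadditive C] [MonoidalLinear k C] [IsFusionCategory k C]

theorem exists_twistedSystem {Γ : Type*} [Group Γ] [Fintype Γ] {ω : ThreeCocycle Γ k}
    (h𝒢 : 𝒢.IsExtensionOf k (TwistedVect ω)) :
    ∃ A : TwistedSystem ω C, (∀ a, 𝒢.component 1 (A.obj a)) ∧
      (∀ a b, a ≠ b → toSkeleton (A.obj a) ≠ toSkeleton (A.obj b)) ∧
      ∀ S : C, Simple S → 𝒢.component 1 S → ∃ a, toSkeleton S = toSkeleton (A.obj a) := by
  have hone : Simple (𝟙_ C) := IsFusionCategory.simple_unit k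
  have := 𝒢.isMonoidal hone
  obtain ⟨-, F₀, _, _, _, ⟨_⟩⟩ := h𝒢
  let F : TwistedVect ω ⥤ C := F₀ ⋙ (𝒢.component 1).ι
  have : F.Additive := inferInstanceAs (F₀ ⋙ (𝒢.component 1).ι).Additive
  have : F.Linear k := inferInstanceAs ((F₀ ⋙ (𝒢.component 1).ι).Linear k)
  have : F.Full := inferInstanceAs (F₀ ⋙ (𝒢.component 1).ι).Full
  have : F.Faithful := inferInstanceAs (F₀ ⋙ (𝒢.component 1).ι).Faithful
  let : F.Monoidal := inferInstanceAs (F₀ ⋙ (𝒢.component 1).ι).Monoidal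
  let A : TwistedSystem ω C := (TwistedVect.lines ω).map F
  have (a : Γ) : Simple (F.obj (TwistedVect.line ω a)) :=
    simple_of_isUnit (A.isUnit_toSkeleton_obj a)
  refine ⟨A, fun a => (F₀.obj _).property, fun a b => toSkeleton_obj_line_ne F, fun S _ hS => ?_⟩
  let e : F.obj (F₀.objPreimage ⟨S, hS⟩) ≅ S :=
    (𝒢.component 1).ι.mapIso (F₀.objObjPreimageIso ⟨S, hS⟩)
  have := Simple.of_iso e
  rw [← congr_toSkeleton_of_iso e]
  exact exists_toSkeleton_obj_eq_line F _

theorem exists_isGeneratedByInvolution [IsAlgClosed k]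
    {ω : ThreeCocycle (Multiplicative (ZMod 2)) k} (h𝒢 : 𝒢.IsExtensionOf k (TwistedVect ω)) :
    ∃ δ : C, 𝒢.IsGeneratedByInvolution δ ∧
      ∀ X : C, Simple X → toSkeleton δ * toSkeleton X = toSkeleton X → ω.IsTrivial := by
  obtain ⟨A, hA_mem, hA_ne, hA_surj⟩ := h𝒢.exists_twistedSystem
  let σ : Multiplicative (ZMod 2) := Multiplicative.ofAdd 1
  have hσ : ∀ a, a = 1 ∨ a = σ := by decide
  have hone : toSkeleton (A.obj 1) = 1 := A.classHom.map_one
  refine ⟨A.obj σ, ⟨hA_mem σ, ?_, ?_, fun S hS hS_mem => ?_⟩, fun X hX hfixed => ?_⟩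
  · have hσ_mul_self : σ * σ = 1 := by decide
    exact (A.classHom.map_mul σ σ).symm.trans ((congrArg A.classHom hσ_mul_self).trans hone)
  · exact hone ▸ hA_ne σ 1 (by decide)
  · obtain ⟨a, ha⟩ := hA_surj S hS hS_mem
    rcases hσ a with rfl | rfl
    exacts [Or.inl (ha.trans hone), Or.inr ha]
  · have fixed (a) : Nonempty (A.obj a ⊗ X ≅ X) := by
      rw [← toSkeleton_eq_toSkeleton_iff, Skeleton.toSkeleton_tensorObj]
      rcases hσ a with rfl | rfl
      exacts [by rw [hone, one_mul], hfixed]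
    have := IsFusionCategory.finiteDimensional_hom (k := k) (C := C)
    exact TwistedSystem.isTrivial_of_fixed
      (fun f => endomorphism_simple_eq_smul_id k f) (id_nonzero X) fun a => (fixed a).some

end FusionGrading.IsExtensionOf

theorem mainTheorem2_general {k : Type u} [Field k] [IsAlgClosed k]
    {C : Type v} [Category.{w} C] [Abelian C] [Linear k C] [MonoidalCategory C]
    [MonoidalPreadditive C] [MonoidalLinear k C] [RigidCategory C] [IsFusionCategory k C]
    {G : Type t} [Group G] [Finite G] (𝒢 : FusionGrading G C)
    (ω : ThreeCocycle (Multiplicative (ZMod 2)) k)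
    (h𝒢 : 𝒢.IsExtensionOf k (TwistedVect ω)) :
    (¬ ω.IsTrivial → IsPointed C) ∧
    (ω.IsTrivial →
      (IsPointed C ∨ IsGeneralizedTambaraYamagami C) ∧
      (IsGeneralizedTambaraYamagami C →
        ∃ n : ℕ,
          Nat.card (InvertibleGroup C) = 2 * n ∧
          IsOfType k C ![1, √2] ![2 * n, n] ∧
          𝒢.component 1 = adjointSubcategory C ∧
          (∃ e : UniversalGradingGroup C ≃* G,
            ∀ u : UniversalGradingGroup C, universalComponent C u = 𝒢.component (e u)) ∧
          Nat.card (UniversalGradingGroup C) = 2 * n)) := by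
  have : Simple (𝟙_ C) := IsFusionCategory.simple_unit k
  obtain ⟨δ, hδ, hfixed⟩ := h𝒢.exists_isGeneratedByInvolution
  refine ⟨fun hω X hX => isInvertibleObj_iff_isUnit.2 ((hδ.isUnit_iff k X).2 fun h =>
    hω (hfixed X hX h)), fun _ => ⟨or_iff_not_imp_left.2 (hδ.isGeneralizedTambaraYamagami k),
    fun hTY => ?_⟩⟩
  obtain ⟨X, _, hX⟩ : ∃ X : C, Simple X ∧ ¬ IsUnit (toSkeleton X) := by
    simpa only [IsPointed, isInvertibleObj_iff_isUnit, not_forall, exists_prop] using hTY.1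
  have hinj : Function.Injective 𝒢.universalHom :=
    FusionGrading.universalHom_injective k fun z hz => hδ.universalDegree_eq_one k hX hz
  let e : UniversalGradingGroup C ≃* G :=
    MulEquiv.ofBijective 𝒢.universalHom ⟨hinj, h𝒢.1.universalHom_surjective k⟩
  have card_nonunits := hδ.card_not_isUnit_eq_card_range k h𝒢.1 hX
  refine ⟨Nat.card 𝒢.degreeHom.range, hδ.card_invertibleGroup,
    hδ.isOfType k (Nat.mul_pos two_pos Nat.card_pos) Nat.card_pos
      (card_isUnit_toSkeleton_rep.trans hδ.card_invertibleGroup) card_nonunits,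
    hδ.component_one_eq_adjointSubcategory k hX,
    ⟨e, FusionGrading.universalComponent_eq k hinj⟩, ?_⟩
  rw [Nat.card_congr e.toEquiv, ← Subgroup.card_mul_index 𝒢.degreeHom.range,
    hδ.index_range_degreeHom k h𝒢.1 hX, mul_comm]

theorem mainTheorem2 {k : Type u} [Field k] [IsAlgClosed k] [CharZero k]
    {C : Type v} [Category.{w} C] [Abelian C] [Linear k C] [MonoidalCategory C]
    [MonoidalPreadditive C] [MonoidalLinear k C] [RigidCategory C] [IsFusionCategory k C]
    {G : Type t} [Group G] [Finite G] (𝒢 : FusionGrading G C)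
    (ω : ThreeCocycle (Multiplicative (ZMod 2)) k)
    (h𝒢 : 𝒢.IsExtensionOf k (TwistedVect ω)) :
    (¬ ω.IsTrivial → IsPointed C) ∧
    (ω.IsTrivial →
      (IsPointed C ∨ IsGeneralizedTambaraYamagami C) ∧
      (IsGeneralizedTambaraYamagami C →
        ∃ n : ℕ,
          Nat.card (InvertibleGroup C) = 2 * n ∧
          IsOfType k C ![1, √2] ![2 * n, n] ∧
          𝒢.component 1 = adjointSubcategory C ∧
          (∃ e : UniversalGradingGroup C ≃* G,
            ∀ u : UniversalGradingGroup C, universalComponent C u = 𝒢.component (e u)) ∧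
          Nat.card (UniversalGradingGroup C) = 2 * n)) :=
  mainTheorem2_general 𝒢 ω h𝒢
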